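/- Let $\mathcal A=\{p_1,\dots,p_n\}\subset\mathbb R^2$ be a finite set of distinct points, labelled so that $p_1,p_2$ do not lie on a common horizontal line, and suppose that no three points of $\mathcal A$ on the boundary of $\operatorname{conv}(\mathcal A)$ are collinear. Let $f=(f_{ij})_{1\le i<j\le n}\cup(f_{0i})_{1\le i\le n}$ be real numbers ($f_{ji}=f_{ij}$), and let $\overline{Y_f}$ be the polyhedron of all $(v,t)\in(\mathbb R^2)^n\times\mathbb R^n$ with $v_1=0$ and $v_2^1=0$ (first coordinate of $v_2$) such that $$\langle p_i-p_j,v_i-v_j\rangle-|p_i-p_j|(t_i+t_j)\ \ge\ f_{ij}\quad(i\ne j),\qquad t_i\ \ge\ f_{0i}\quad(1\le i\le n).$$ *Marked graphs.* A marked graph on $\mathcal A$ is a straight-line graph with vertex set $\mathcal A$ together with a set of marked vertices. It is *non-crossing* if no edge meets another edge or a point of $\mathcal A$ except at its end-points, and every marked vertex is pointed; here a vertex $p$ is *pointed* if it is an extreme point of $\operatorname{conv}(\mathcal A)$, or it is a non-extreme boundary point of $\operatorname{conv}(\mathcal A)$ not incident to any edge going through the interior of $\operatorname{conv}(\mathcal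 A)$, or it is interior to $\operatorname{conv}(\mathcal A)$ and its incident edges lie in a closed half-plane with $p$ on its boundary line. *Validity.* The strict supporting graph of a nonempty face $F$ of $\overline{Y_f}$ consists of all edges $p_ip_j$ and marks $p_i$ whose inequality above is an equality on $F$; the weak supporting graph consists of those among them whose inequality defines a facet of $\overline{Y_f}$. The choice $f$ is *strictly* (resp. *weakly*) *valid* if the strict (resp. weak) supporting graphs of all nonempty faces of $\overline{Y_f}$ are non-crossing. A *stress* on points $p_1,\dots,p_k$ is a family of scalars $w_{ij}$ $(i<j)$, $\alpha_i$ with $$\sum_{i<j}w_{ij}\bigl(\langle p_i-p_j,v_i-v_j\rangle-|p_i-p_j|(t_i+t_j)\bigr)+\sum_i\alpha_it_i=0\quad\text{for all }(v,t)\in(\mathbb R^2)^k\times\mathbb R^k.$$ **Theorem.** Assume the following three families of inequalities, where in each case the points of $\mathcal A$ involved are renamed $p_1,p_2,\dots$: 1. for every four points of $\mathcal A$, no three of them collinear, $$\sum_{1\le i<j\le4}w_{ij}f_{ij}+\sum_{j=1}^4\alpha_jf_{0j}>0,\qquad w_{ij}=\frac1{\det(p_i,p_j,p_k)\det(p_i,p_j,p_l)},\quad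 \alpha_i=\sum_{j\ne i}w_{ij}|p_i-p_j|,$$ where $\{i,j,k,l\}=\{1,2,3,4\}$ and $\det(x,y,z)$ is twice the signed area of the triangle $xyz$; 2. for every three points $p_1,p_2,p_3$ of $\mathcal A$ collinear in this order, $$\frac{f_{12}}{|p_2-p_1|}-\frac{f_{13}}{|p_3-p_1|}+\frac{f_{23}}{|p_3-p_2|}+2f_{02}\ \ge\ 0;$$ 3. for every five points of $\mathcal A$ such that $p_1,p_2,p_3,p_4$ are the vertices, in cyclic order, of a convex quadrilateral and $p_5$ is the intersection of its diagonals, $$\sum_{1\le i<j\le5}w_{ij}f_{ij}+\sum_{j=1}^5\alpha_jf_{0j}>0$$ for the stresses $(w,\alpha)$ on these five points with $w_{13}=w_{24}=0$, $w_{12},w_{23},w_{34},w_{14}>0$, $w_{15},w_{25},w_{35},w_{45}<0$, $\alpha_1,\alpha_2,\alpha_3,\alpha_4>0$ and $\alpha_5<0$. Then $f$ is weakly valid. If moreover the inequalities in (2) are strict for all collinear triples, then $f$ is strictly valid. More precisely, $f$ is strictly valid if and only if the inequality in (2) is strict for every collinear triple $p_1,p_2,p_3$ of consecutive points, that is, such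 that $p_2$ is the only point of $\mathcal A$ strictly between $p_1$ and $p_3$. (If no four points of $\mathcal A$ are collinear, these are all the collinear triples.) -/

import Mathlib

noncomputable section

/-- The Euclidean plane. -/
abbrev Plane := EuclideanSpace ℝ (Fin 2)

/-- The vectors `(v, t)`: a velocity `v i` in the plane and a number `t i` for each index `i`. -/
abbrev Motion (ι : Type*) := (ι → Plane) × (ι → ℝ)

/-- A marked graph: a graph on the (indices of the) points together with a set of marked points. -/
structure MarkedGraph (ι : Type*) where
  graph : SimpleGraph ι
  marks : Set ι

section PointSets

variable {ι : Type*}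

/-! ### Non-crossing marked graphs on a point set -/

/-- The convex hull of the point set `p`. -/
def hull (p : ι → Plane) : Set Plane := convexHull ℝ (Set.range p)

/-- No edge meets another edge, or a point of the set, except at its end-points. -/
def IsNonCrossing (p : ι → Plane) (G : SimpleGraph ι) : Prop :=
  (∀ i j k, G.Adj i j → p k ∈ segment ℝ (p i) (p j) → k = i ∨ k = j) ∧
  (∀ i j k l, G.Adj i j → G.Adj k l → s(i, j) ≠ s(k, l) →
    ∀ x, x ∈ segment ℝ (p i) (p j) → x ∈ segment ℝ (p k) (p l) →
      (x = p i ∨ x = p j) ∧ (x = p k ∨ x = p l))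

/-- The point `i` is pointed in `G` if it is an extremal point of the convex hull, or it is a
non-extremal boundary point with no incident edge going through the interior of the hull, or it is
an interior point whose incident edges span at most 180 degrees, that is, lie in a closed
half-plane with `p i` on its boundary line. -/
def IsPointed (p : ι → Plane) (G : SimpleGraph ι) (i : ι) : Prop :=
  p i ∈ (hull p).extremePoints ℝ ∨
  (p i ∈ frontier (hull p) ∧ p i ∉ (hull p).extremePoints ℝ ∧
    ∀ j, G.Adj i j → Disjoint (openSegment ℝ (p i) (p j)) (interior (hull p))) ∨
  (p i ∈ interior (hull p) ∧
    ∃ u : Plane, u ≠ 0 ∧ ∀ j, G.Adj i j → 0 ≤ inner ℝ u (p j - p i))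

/-- A marked graph is non-crossing if its graph is and if only pointed vertices are marked. -/
def MarkedGraph.NonCrossing (p : ι → Plane) (T : MarkedGraph ι) : Prop :=
  IsNonCrossing p T.graph ∧ ∀ i ∈ T.marks, IsPointed p T.graph i

/-- No three points of the set that lie on the boundary of its convex hull are collinear. -/
def NoThreeCollinearBoundary (p : ι → Plane) : Prop :=
  ∀ i j k, i ≠ j → i ≠ k → j ≠ k →
    p i ∈ frontier (hull p) → p j ∈ frontier (hull p) → p k ∈ frontier (hull p) →
      ¬ Collinear ℝ {p i, p j, p k}

/-! ### The polyhedron of constrained expansions -/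

/-- The linear form `⟨pᵢ - pⱼ, vᵢ - vⱼ⟩ - |pᵢ - pⱼ| (tᵢ + tⱼ)`. -/
def edgeForm (p : ι → Plane) (i j : ι) (x : Motion ι) : ℝ :=
  inner ℝ (p i - p j) (x.1 i - x.1 j) - dist (p i) (p j) * (x.2 i + x.2 j)

/-- The space of motions normalised, with respect to two points `a`, `b` not on one horizontal
line, by `v_a = 0` and by the vanishing of the first coordinate of `v_b`. -/
def normalizedMotions (a b : ι) : Set (Motion ι) :=
  {x | x.1 a 0 = 0 ∧ x.1 a 1 = 0 ∧ x.1 b 0 = 0}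

/-- The polyhedron of expansions constrained by `f`. The number `f s(i, j)` is the constraint for
the edge `ij` (values of `f` on the diagonal are never used), and `f₀ i` the one for the mark at
`i`. -/
def expansionPolyhedron (p : ι → Plane) (a b : ι) (f : Sym2 ι → ℝ) (f₀ : ι → ℝ) :
    Set (Motion ι) :=
  {x | x ∈ normalizedMotions a b ∧ (∀ i j, i ≠ j → f s(i, j) ≤ edgeForm p i j x) ∧
    ∀ i, f₀ i ≤ x.2 i}

/-- `F` is a facet of the polyhedron `Y`: a nonempty face of dimension one less. -/
def IsFacet (Y F : Set (Motion ι)) : Prop :=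
  IsExposed ℝ Y F ∧ F.Nonempty ∧
    Module.finrank ℝ (vectorSpan ℝ F) + 1 = Module.finrank ℝ (vectorSpan ℝ Y)

lemma edgeForm_comm (p : ι → Plane) (i j : ι) (x : Motion ι) :
    edgeForm p i j x = edgeForm p j i x := by
  unfold edgeForm
  rw [← neg_sub (p j) (p i), ← neg_sub (x.1 j) (x.1 i), inner_neg_neg, dist_comm,
    add_comm (x.2 i)]

/-- The strict supporting graph of a face `F`: all edges and marks that are tight on `F`. -/
def strictSupport (p : ι → Plane) (f : Sym2 ι → ℝ) (f₀ : ι → ℝ) (F : Set (Motion ι)) :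
    MarkedGraph ι where
  graph :=
    { Adj := fun i j => i ≠ j ∧ ∀ x ∈ F, edgeForm p i j x = f s(i, j)
      symm := ⟨fun i j h => ⟨h.1.symm, fun x hx => by
        rw [edgeForm_comm, Sym2.eq_swap]; exact h.2 x hx⟩⟩
      loopless := ⟨fun _ h => h.1 rfl⟩ }
  marks := {i | ∀ x ∈ F, x.2 i = f₀ i}

/-- The weak supporting graph of a face `F`: the edges and marks that are tight on `F` and define
facets of the polyhedron. -/
def weakSupport (p : ι → Plane) (a b : ι) (f : Sym2 ι → ℝ) (f₀ : ι → ℝ) (F : Set (Motion ι)) :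
    MarkedGraph ι where
  graph :=
    { Adj := fun i j => (strictSupport p f f₀ F).graph.Adj i j ∧
        IsFacet (expansionPolyhedron p a b f f₀)
          {x ∈ expansionPolyhedron p a b f f₀ | edgeForm p i j x = f s(i, j)}
      symm := ⟨fun i j h => ⟨h.1.symm, by
        have h2 := h.2
        simp only [edgeForm_comm p i j, Sym2.eq_swap (a := i) (b := j)] at h2
        exact h2⟩⟩
      loopless := ⟨fun _ h => h.1.ne rfl⟩ }
  marks := {i | i ∈ (strictSupport p f f₀ F).marks ∧
    IsFacet (expansionPolyhedron p a b f f₀)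
      {x ∈ expansionPolyhedron p a b f f₀ | x.2 i = f₀ i}}

/-- `f` is weakly valid: the weak supporting graphs of all (nonempty) faces are non-crossing. -/
def WeaklyValid (p : ι → Plane) (a b : ι) (f : Sym2 ι → ℝ) (f₀ : ι → ℝ) : Prop :=
  ∀ F : Set (Motion ι), IsExposed ℝ (expansionPolyhedron p a b f f₀) F → F.Nonempty →
    (weakSupport p a b f f₀ F).NonCrossing p

/-- `f` is strictly valid: the strict supporting graphs of all (nonempty) faces are
non-crossing. -/
def StrictlyValid (p : ι → Plane) (a b : ι) (f : Sym2 ι → ℝ) (f₀ : ι → ℝ) : Prop :=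
  ∀ F : Set (Motion ι), IsExposed ℝ (expansionPolyhedron p a b f f₀) F → F.Nonempty →
    (strictSupport p f f₀ F).NonCrossing p

/-! ### The linear inequalities -/

/-- The sum `∑_{i<j} wᵢⱼ fᵢⱼ + ∑ᵢ αᵢ f₀ᵢ` over the points with indices `e 0, …, e (k - 1)`. -/
def stressSum {k : ℕ} (e : Fin k → ι) (w : Fin k → Fin k → ℝ) (α : Fin k → ℝ)
    (f : Sym2 ι → ℝ) (f₀ : ι → ℝ) : ℝ :=
  ∑ i, ∑ j ∈ Finset.Ioi i, w i j * f s(e i, e j) + ∑ i, α i * f₀ (e i)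

/-- `w`, `α` form a stress of the complete marked graph on `q 0, …, q (k - 1)`; only the entries
`w i j` with `i < j` matter. -/
def IsStress {k : ℕ} (q : Fin k → Plane) (w : Fin k → Fin k → ℝ) (α : Fin k → ℝ) : Prop :=
  ∀ x : Motion (Fin k),
    ∑ i, ∑ j ∈ Finset.Ioi i, w i j * edgeForm q i j x + ∑ i, α i * x.2 i = 0

/-- The determinant of three points of the plane (in homogeneous coordinates): twice the signed
area of the triangle that they span. -/
def det3 (x y z : Plane) : ℝ :=
  Matrix.det !![1, 1, 1; x 0, y 0, z 0; x 1, y 1, z 1]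

/-- No three of the four points are collinear. -/
def GeneralPosition (q : Fin 4 → Plane) : Prop :=
  ∀ i j k, i ≠ j → i ≠ k → j ≠ k → ¬ Collinear ℝ {q i, q j, q k}

/-- `wᵢⱼ = 1 / (det(pᵢ, pⱼ, pₖ) det(pᵢ, pⱼ, pₗ))`, with `k`, `l` the two other indices. -/
def fourW (q : Fin 4 → Plane) (i j : Fin 4) : ℝ :=
  ∏ k ∈ ({i, j} : Finset (Fin 4))ᶜ, (det3 (q i) (q j) (q k))⁻¹

/-- `αᵢ = ∑_{j ≠ i} wᵢⱼ |pᵢ - pⱼ|`. -/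
def fourAlpha (q : Fin 4 → Plane) (i : Fin 4) : ℝ :=
  ∑ j ∈ ({i} : Finset (Fin 4))ᶜ, fourW q i j * dist (q i) (q j)

/-- The inequalities for all quadruples of points in general position. -/
def FourPointInequalities (p : ι → Plane) (f : Sym2 ι → ℝ) (f₀ : ι → ℝ) : Prop :=
  ∀ e : Fin 4 → ι, GeneralPosition (p ∘ e) →
    0 < stressSum e (fourW (p ∘ e)) (fourAlpha (p ∘ e)) f f₀

/-- The linear expression of three points collinear in the order `i`, `j`, `k`. -/
def tripleSum (p : ι → Plane) (f : Sym2 ι → ℝ) (f₀ : ι → ℝ) (i j k : ι) : ℝ :=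
  f s(i, j) / dist (p i) (p j) - f s(i, k) / dist (p i) (p k) + f s(j, k) / dist (p j) (p k)
    + 2 * f₀ j

/-- The points `q 0, q 1, q 2, q 3` are the vertices, in cyclic order, of a convex quadrilateral
and `q 4` is the intersection of its diagonals. -/
def IsCrossedQuadrilateral (q : Fin 5 → Plane) : Prop :=
  Sbtw ℝ (q 0) (q 4) (q 2) ∧ Sbtw ℝ (q 1) (q 4) (q 3) ∧ ¬ Collinear ℝ {q 0, q 1, q 4}

/-- The sign pattern on a quadrilateral with the intersection point of its diagonals: positive on
the sides and on the marks of the four vertices, negative on the four edges to the middle point and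
on its mark, zero on the two missing edges (the diagonals). -/
def HasWheelSigns (w : Fin 5 → Fin 5 → ℝ) (α : Fin 5 → ℝ) : Prop :=
  (0 < w 0 1 ∧ 0 < w 1 2 ∧ 0 < w 2 3 ∧ 0 < w 0 3) ∧
  (w 0 2 = 0 ∧ w 1 3 = 0) ∧
  (w 0 4 < 0 ∧ w 1 4 < 0 ∧ w 2 4 < 0 ∧ w 3 4 < 0) ∧
  (0 < α 0 ∧ 0 < α 1 ∧ 0 < α 2 ∧ 0 < α 3 ∧ α 4 < 0)

/-- The inequalities for all five-point configurations consisting of a convex quadrilateral and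
the intersection of its diagonals. -/
def FivePointInequalities (p : ι → Plane) (f : Sym2 ι → ℝ) (f₀ : ι → ℝ) : Prop :=
  ∀ e : Fin 5 → ι, IsCrossedQuadrilateral (p ∘ e) →
    ∀ (w : Fin 5 → Fin 5 → ℝ) (α : Fin 5 → ℝ), IsStress (p ∘ e) w α → HasWheelSigns w α →
      0 < stressSum e w α f f₀

/-- The points `i`, `j`, `k` are collinear in this order and `j` is the only point of the set
strictly between `i` and `k`. -/
def IsConsecutiveTriple (p : ι → Plane) (i j k : ι) : Prop :=
  Sbtw ℝ (p i) (p j) (p k) ∧ ∀ l, Sbtw ℝ (p i) (p l) (p k) → l = j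

end PointSets

end

/-!
# Non-crossing graphs from the polyhedron of constrained expansions

The slack of an edge or mark at a point `x` of the polyhedron is the difference of the two sides of
its inequality. A stress `(w, α)` turns into the relation
`∑ wᵢⱼ slackᵢⱼ + ∑ αᵢ slackᵢ = -stressSum`. If the stress sum is positive, some edge or mark of
negative weight therefore has positive slack, i.e. is not tight (`not_stressSum_pos`). This
excludes the local obstructions to being non-crossing:

* two crossing edges, by the stress of four points in convex position, which is negative exactly on
  the two diagonals (`not_tight_of_crossing`);
* a marked point that is not pointed. It is interior to the hull, because a point outside the
  interior is extreme when no three boundary points are collinear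
  (`mem_extremePoints_of_not_mem_interior`), and its edges lie in no closed half-plane, so that
  three of them surround it or four of them form a cross (`exists_triangle_or_cross`). The first
  case is excluded by the stress of a triangle with an interior point (`not_tight_of_triangle`), the
  second by the stress of a wheel with four spokes (`not_tight_of_cross`).

What remains are edges `i k` through a third point `j`. By `slack_collinear` the slack of `i k` is
a positive combination of those of `i j`, `j k`, of the mark `j`, and of `tripleSum`. If `tripleSum`
is positive the edge is never tight. If it is zero, the face of `i k` lies in the faces of `i j` and
of the mark `j`; since the polyhedron contains points that differ only in a single mark, that face
has codimension at least two and is no facet (`not_isFacet_of_sbtw`). This gives weak validity, and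
strict validity if consecutive triples are strict, because a shortest tight edge through a further
point belongs to a consecutive triple (`not_sbtw_of_tight`).

Conversely, if `tripleSum` vanishes for a consecutive triple, then `i k` is tight at some point of
the polyhedron: with `i j`, `j k` and all marks tight, the other constraints are satisfied by
stretching the set along the line, which needs no point to lie between `i` and `k` except `j`, and
then stretching it across the line (`exists_tight_of_tripleSum_eq_zero`).
-/

/-! ### Plane vectors -/

/-- The determinant of two vectors of the plane. -/
def det2 (d e : Plane) : ℝ := d 0 * e 1 - d 1 * e 0

/-- Counterclockwise rotation by a right angle. -/
def rot (d : Plane) : Plane := !₂[-d 1, d 0]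

lemma plane_inner (x y : Plane) : inner ℝ x y = x 0 * y 0 + x 1 * y 1 := by
  simp [PiLp.inner_apply, Fin.sum_univ_two, mul_comm]

lemma inner_rot (d x : Plane) : inner ℝ (rot d) x = det2 d x := by
  simp [plane_inner, rot, det2]; ring

lemma plane_ext {x y : Plane} (h0 : x 0 = y 0) (h1 : x 1 = y 1) : x = y := by
  ext i; fin_cases i <;> assumption

lemma rot_ne_zero {d : Plane} (hd : d ≠ 0) : rot d ≠ 0 := by
  intro h
  apply hd
  have h0 := congrArg (fun v : Plane => v 0) h
  have h1 := congrArg (fun v : Plane => v 1) h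
  simp [rot] at h0 h1
  exact plane_ext (by simpa using h1) (by simpa using h0)

lemma det2_smul_right (d e : Plane) (c : ℝ) : det2 d (c • e) = c * det2 d e := by
  simp [det2]; ring

lemma det2_swap (d e : Plane) : det2 d e = -det2 e d := by
  simp [det2]; ring

lemma exists_eq_smul_of_det2_eq_zero {d e : Plane} (hd : d ≠ 0) (h : det2 d e = 0) :
    ∃ r : ℝ, e = r • d := by
  have hn : d 0 * d 0 + d 1 * d 1 ≠ 0 := by
    intro h0
    apply hd
    have := mul_self_nonneg (d 0)
    have := mul_self_nonneg (d 1)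
    exact plane_ext (by simpa using (by linarith : d 0 * d 0 = 0))
      (by simpa using (by linarith : d 1 * d 1 = 0))
  unfold det2 at h
  refine ⟨(d 0 * e 0 + d 1 * e 1) / (d 0 * d 0 + d 1 * d 1), plane_ext ?_ ?_⟩ <;>
    rw [PiLp.smul_apply, smul_eq_mul, div_mul_eq_mul_div, eq_div_iff hn]
  · linear_combination (-d 1) * h
  · linear_combination (d 0) * h

lemma det2_of_sameRay {x y : Plane} (h : SameRay ℝ x y) : det2 x y = 0 := by
  rcases h with rfl | rfl | ⟨r, s, hr, hs, h⟩
  · simp [det2]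
  · simp [det2]
  · have h1 : r * det2 x y = 0 := by
      have : s * det2 y y = r * det2 x y := by
        have h0 := congrArg (fun v : Plane => v 0) h
        have h1 := congrArg (fun v : Plane => v 1) h
        simp only [PiLp.smul_apply, smul_eq_mul] at h0 h1
        unfold det2
        linear_combination (-y 1) * h0 + y 0 * h1
      rw [← this, det2]; ring
    simpa [hr.ne'] using h1

/-- The strict triangle inequality for two independent vectors. -/
lemma mul_norm_lt_of_smul_add_smul_eq {x y z : Plane} {r s u : ℝ} (hr : 0 < r) (hs : 0 < s)
    (hu : 0 < u) (hxy : det2 x y ≠ 0) (h : r • x + s • y = u • z) :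
    u * ‖z‖ < r * ‖x‖ + s * ‖y‖ := by
  have h1 : ¬ SameRay ℝ (r • x) (s • y) := by
    intro h
    have h3 := det2_of_sameRay h
    rw [det2_smul_right, det2_swap, det2_smul_right, det2_swap] at h3
    simp [hr.ne', hs.ne', hxy] at h3
  have h2 := norm_add_lt_of_not_sameRay h1
  rwa [h, norm_smul, norm_smul, norm_smul, Real.norm_of_nonneg hr.le, Real.norm_of_nonneg hs.le,
    Real.norm_of_nonneg hu.le] at h2

lemma det3_eq (x y z : Plane) : det3 x y z = det2 (y - x) (z - x) := by
  simp [det3, det2, Matrix.det_fin_three]; ring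

lemma det3_of_collinear {x y z : Plane} (h : Collinear ℝ {x, y, z}) : det3 x y z = 0 := by
  obtain ⟨v, hv⟩ := (collinear_iff_of_mem (p₀ := x) (by simp)).1 h
  obtain ⟨r, hr⟩ := hv y (by simp)
  obtain ⟨s, hs⟩ := hv z (by simp)
  rw [det3_eq, hr, hs]
  simp [det2]; ring

lemma collinear_of_det2_eq_zero {x y z : Plane} (h : det2 (y - x) (z - x) = 0) :
    Collinear ℝ {x, y, z} := by
  by_cases hxy : y = x
  · subst hxy; simpa using collinear_pair ℝ y z
  · obtain ⟨r, hr⟩ := exists_eq_smul_of_det2_eq_zero (sub_ne_zero.2 hxy) h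
    refine (collinear_iff_of_mem (p₀ := x) (by simp)).2 ⟨y - x, ?_⟩
    simp only [Set.mem_insert_iff, Set.mem_singleton_iff, forall_eq_or_imp, forall_eq]
    refine ⟨⟨0, by simp⟩, ⟨1, by simp⟩, ⟨r, ?_⟩⟩
    simp [← hr]

/-- If finitely many nonzero vectors of the plane lie in no closed half-plane, then either three
of them contain the origin in the interior of their triangle, or two pairs of opposite vectors
among them form a cross. -/
lemma exists_triangle_or_cross {ι : Type*} (S : Finset ι) (d : ι → Plane)
    (hd : ∀ i ∈ S, d i ≠ 0) (hS : ∀ u : Plane, u ≠ 0 → ∃ i ∈ S, inner ℝ u (d i) < 0) :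
    (∃ i ∈ S, ∃ j ∈ S, ∃ k ∈ S,
      0 < det2 (d i) (d j) ∧ 0 < det2 (d j) (d k) ∧ 0 < det2 (d k) (d i)) ∨
    (∃ i ∈ S, ∃ j ∈ S, ∃ k ∈ S, ∃ l ∈ S, 0 < det2 (d i) (d j) ∧
      (∃ r : ℝ, 0 < r ∧ d k = (-r) • d i) ∧ ∃ s : ℝ, 0 < s ∧ d l = (-s) • d j) := by
  by_cases hT : ∃ i ∈ S, ∃ j ∈ S, ∃ k ∈ S,
      0 < det2 (d i) (d j) ∧ 0 < det2 (d j) (d k) ∧ 0 < det2 (d k) (d i)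
  · exact Or.inl hT
  right
  have hpos : ∀ i ∈ S, ∃ j ∈ S, 0 < det2 (d i) (d j) := by
    intro i hi
    obtain ⟨j, hj, hij⟩ := hS (-rot (d i)) (neg_ne_zero.2 (rot_ne_zero (hd i hi)))
    rw [inner_neg_left, inner_rot] at hij
    exact ⟨j, hj, by linarith⟩
  have hopp : ∀ i ∈ S, ∃ k ∈ S, ∃ r : ℝ, 0 < r ∧ d k = (-r) • d i := by
    intro i hi
    -- `j` makes the largest angle with `d i` among the vectors to the left of `d i`
    obtain ⟨j, hj, hmax⟩ := (S.filter fun j => 0 < det2 (d i) (d j)).exists_min_image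
      (fun j => inner ℝ (d i) (d j) / det2 (d i) (d j))
      (by obtain ⟨j, hj, h⟩ := hpos i hi; exact ⟨j, by simp [hj, h]⟩)
    simp only [Finset.mem_filter, and_imp] at hj hmax
    obtain ⟨k, hk, hjk⟩ := hpos j hj.1
    refine ⟨k, hk, ?_⟩
    have hid : det2 (d j) (d k) * inner ℝ (d i) (d i) =
        inner ℝ (d i) (d j) * det2 (d i) (d k) - inner ℝ (d i) (d k) * det2 (d i) (d j) := by
      simp only [plane_inner, det2]; ring
    have hii : 0 < inner ℝ (d i) (d i) := real_inner_self_pos.2 (hd i hi)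
    -- `k` is to the left of `d j`: it cannot be to the right of `d i`, as there is no triangle, nor
    -- to the left of it, by the choice of `j`
    have hik : det2 (d i) (d k) = 0 := by
      rcases lt_trichotomy (det2 (d i) (d k)) 0 with h | h | h
      · exact absurd ⟨i, hi, j, hj.1, k, hk, hj.2, hjk, by rw [det2_swap]; linarith⟩ hT
      · exact h
      · have h1 := hmax k hk h
        rw [div_le_div_iff₀ hj.2 h] at h1
        have := mul_pos hjk hii
        linarith
    obtain ⟨r, hr⟩ := exists_eq_smul_of_det2_eq_zero (hd i hi) hik
    refine ⟨-r, ?_, by simpa using hr⟩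
    rw [hr, det2_smul_right, det2_swap] at hjk
    nlinarith [hj.2]
  obtain ⟨i, hi⟩ : ∃ i, i ∈ S := by
    obtain ⟨i, hi, -⟩ := hS !₂[1, 0] (fun h => by
      have := congrArg (fun v : Plane => v 0) h
      simp at this)
    exact ⟨i, hi⟩
  obtain ⟨j, hj, hij⟩ := hpos i hi
  obtain ⟨k, hk, hr⟩ := hopp i hi
  obtain ⟨l, hl, hs⟩ := hopp j hj
  exact ⟨i, hi, j, hj, k, hk, l, hl, hij, hr, hs⟩

/-! ### Boundary points of the hull -/

section Hull

variable {ι : Type*} {p : ι → Plane}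

lemma mem_hull (p : ι → Plane) (i : ι) : p i ∈ hull p :=
  subset_convexHull ℝ _ (Set.mem_range_self i)

/-- A point that strictly maximises a linear functional on the point set is extreme. -/
lemma mem_extremePoints_hull {i : ι} (u : Plane)
    (hu : ∀ l, p l ≠ p i → inner ℝ u (p l - p i) < 0) : p i ∈ (hull p).extremePoints ℝ := by
  have hsub : hull p ⊆ {y | y = p i ∨ inner ℝ u (y - p i) < 0} := by
    apply convexHull_min
    · rintro _ ⟨l, rfl⟩
      by_cases h : p l = p i
      · exact Or.inl h
      · exact Or.inr (hu l h)
    · rw [convex_iff_openSegment_subset]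
      rintro y hy z hz _ ⟨r, s, hr, hs, hrs, rfl⟩
      have hE : r • y + s • z - p i = r • (y - p i) + s • (z - p i) := by
        have : p i = (r + s) • p i := by rw [hrs, one_smul]
        nth_rw 1 [this]; module
      simp only [Set.mem_ofPred_eq] at hy hz ⊢
      rcases hy with rfl | hy <;> rcases hz with rfl | hz
      · left; rw [← add_smul, hrs, one_smul]
      · right; rw [hE, inner_add_right, inner_smul_right, inner_smul_right]
        simp; nlinarith
      · right; rw [hE, inner_add_right, inner_smul_right, inner_smul_right]
        simp; nlinarith
      · right; rw [hE, inner_add_right, inner_smul_right, inner_smul_right]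
        nlinarith
  rw [mem_extremePoints_iff_left]
  refine ⟨mem_hull p i, ?_⟩
  rintro y hy z hz ⟨r, s, hr, hs, hrs, hE⟩
  have h0 : r * inner ℝ u (y - p i) + s * inner ℝ u (z - p i) = 0 := by
    have h1 : r • (y - p i) + s • (z - p i) = 0 := by
      have h2 : r • (y - p i) + s • (z - p i) = r • y + s • z - (r + s) • p i := by module
      rw [h2, hE, hrs, one_smul, sub_self]
    rw [← inner_smul_right, ← inner_smul_right, ← inner_add_right, h1, inner_zero_right]
  have hz' : inner ℝ u (z - p i) ≤ 0 := by
    rcases hsub hz with h | h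
    · simp [h]
    · exact h.le
  rcases hsub hy with h | h
  · exact h
  · nlinarith

/-- A point of the hull outside its interior lies on a supporting line. -/
lemma exists_supporting {i : ι} (hi : p i ∉ interior (hull p)) :
    ∃ u : Plane, u ≠ 0 ∧ ∀ l, inner ℝ u (p l - p i) ≤ 0 := by
  have hconv : Convex ℝ (hull p) := convex_convexHull ℝ _
  by_cases hne : (interior (hull p)).Nonempty
  · obtain ⟨f, hf0, hf⟩ := geometric_hahn_banach_of_nonempty_interior_point hconv hi hne
    refine ⟨(InnerProductSpace.toDual ℝ Plane).symm f, by simpa using hf0, fun l => ?_⟩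
    rw [InnerProductSpace.toDual_symm_apply, map_sub]
    linarith [hf _ (mem_hull p l)]
  · rw [hull, interior_convexHull_nonempty_iff_affineSpan_eq_top] at hne
    have hdir : vectorSpan ℝ (Set.range p) ≠ ⊤ := by
      intro h
      exact hne ((AffineSubspace.affineSpan_eq_top_iff_vectorSpan_eq_top_of_nonempty ℝ Plane Plane
        ⟨p i, Set.mem_range_self i⟩).2 h)
    have h2 : (vectorSpan ℝ (Set.range p))ᗮ ≠ ⊥ := fun h =>
      hdir ((Submodule.orthogonal_eq_bot_iff).1 h)
    obtain ⟨u, hu, hu0⟩ := Submodule.exists_mem_ne_zero_of_ne_bot h2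
    refine ⟨u, hu0, fun l => le_of_eq ?_⟩
    exact Submodule.inner_left_of_mem_orthogonal
      (vsub_mem_vectorSpan ℝ (Set.mem_range_self l) (Set.mem_range_self i)) hu

/-- If no three boundary points are collinear, then every point outside the interior of the hull
is extreme: its supporting line contains at most one other point, so the line can be tilted. -/
lemma mem_extremePoints_of_not_mem_interior [Finite ι] (hp : Function.Injective p)
    (hA : NoThreeCollinearBoundary p) {i : ι} (hi : p i ∉ interior (hull p)) :
    p i ∈ (hull p).extremePoints ℝ := by
  obtain ⟨u, hu0, hu⟩ := exists_supporting hi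
  have hfr : ∀ l, inner ℝ u (p l - p i) = 0 → p l ∈ frontier (hull p) := by
    intro l hl
    refine ⟨subset_closure (mem_hull p l), fun hint => ?_⟩
    have hsub : hull p ⊆ {y | inner ℝ u (y - p i) ≤ 0} := by
      apply convexHull_min
      · rintro _ ⟨m, rfl⟩; exact hu m
      · have : {y : Plane | inner ℝ u (y - p i) ≤ 0} = {y | inner ℝ u y ≤ inner ℝ u (p i)} := by
          ext y; simp [inner_sub_right]
        rw [this]
        exact convex_halfSpace_le (innerₛₗ ℝ u).isLinear _
    have hlim : Filter.Tendsto (fun r : ℝ => p l + r • u) (nhdsWithin 0 (Set.Ioi 0))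
        (nhds (p l)) := by
      have : Filter.Tendsto (fun r : ℝ => p l + r • u) (nhds 0) (nhds (p l + (0 : ℝ) • u)) :=
        Continuous.tendsto (by fun_prop) 0
      rw [zero_smul, add_zero] at this
      exact this.mono_left nhdsWithin_le_nhds
    have hev := hlim.eventually (isOpen_interior.mem_nhds hint)
    obtain ⟨r, hr, hr0⟩ := (hev.and self_mem_nhdsWithin).exists
    have h1 : inner ℝ u (p l + r • u - p i) ≤ 0 := hsub (interior_subset hr)
    have h2 : p l + r • u - p i = (p l - p i) + r • u := by abel
    rw [h2, inner_add_right, hl, inner_smul_right] at h1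
    have h3 : 0 < inner ℝ u u := real_inner_self_pos.2 hu0
    have h4 : 0 < r := hr0
    nlinarith
  have hline : ∀ l m, l ≠ i → m ≠ i → inner ℝ u (p l - p i) = 0 → inner ℝ u (p m - p i) = 0 →
      l = m := by
    intro l m hl hm hl0 hm0
    by_contra hlm
    refine hA i l m hl.symm hm.symm hlm (hfr i (by simp)) (hfr l hl0) (hfr m hm0)
      (collinear_of_det2_eq_zero ?_)
    have h1 : inner ℝ u u * det2 (p l - p i) (p m - p i) =
        inner ℝ u (p l - p i) * det2 u (p m - p i) -
          inner ℝ u (p m - p i) * det2 u (p l - p i) := by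
      simp only [plane_inner, det2]; ring
    rw [hl0, hm0] at h1
    simpa [hu0] using h1
  by_cases hm : ∃ m, m ≠ i ∧ inner ℝ u (p m - p i) = 0
  · obtain ⟨m, hmi, hm0⟩ := hm
    -- tilting `u` slightly away from `p m` makes `p i` the only maximum
    have hev : ∀ᶠ r in nhdsWithin (0 : ℝ) (Set.Ioi 0), ∀ l, l ≠ i →
        inner ℝ (u - r • (p m - p i)) (p l - p i) < 0 := by
      rw [Filter.eventually_all]
      intro l
      by_cases hli : l = i
      · simp [hli]
      by_cases hl0 : inner ℝ u (p l - p i) = 0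
      · rw [hline l m hli hmi hl0 hm0]
        filter_upwards [self_mem_nhdsWithin] with r hr _
        have h3 : 0 < inner ℝ (p m - p i) (p m - p i) :=
          real_inner_self_pos.2 (sub_ne_zero.2 (hp.ne hmi))
        rw [inner_sub_left, hm0, inner_smul_left]
        have : 0 < r := hr
        simp only [conj_trivial]
        nlinarith
      · have hlt := lt_of_le_of_ne (hu l) hl0
        have hlim : Filter.Tendsto (fun r : ℝ => inner ℝ (u - r • (p m - p i)) (p l - p i))
            (nhds 0) (nhds (inner ℝ (u - (0 : ℝ) • (p m - p i)) (p l - p i))) :=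
          Continuous.tendsto (by fun_prop) 0
        rw [zero_smul, sub_zero] at hlim
        filter_upwards [(hlim.mono_left nhdsWithin_le_nhds).eventually (gt_mem_nhds hlt)]
          with r hr _ using hr
    obtain ⟨r, hr⟩ := hev.exists
    exact mem_extremePoints_hull _ fun l hl => hr l (fun h => hl (by rw [h]))
  · push Not at hm
    refine mem_extremePoints_hull u fun l hl => lt_of_le_of_ne (hu l) (hm l fun h => hl (by rw [h]))

end Hull

/-! ### Stresses -/

section Stress

/-- Symmetric weights in equilibrium at every point form a stress, with the marks weighted by
`α i = ∑ j ≠ i, w i j * |q i - q j|`. -/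
lemma isStress_of_equilibrium {k : ℕ} (q : Fin k → Plane) (w : Fin k → Fin k → ℝ)
    (hsymm : ∀ i j, i ≠ j → w i j = w j i)
    (heq : ∀ i, ∑ j ∈ ({i} : Finset (Fin k))ᶜ, w i j • (q i - q j) = 0) :
    IsStress q w (fun i => ∑ j ∈ ({i} : Finset (Fin k))ᶜ, w i j * dist (q i) (q j)) := by
  intro x
  -- the part of the term of the edge `i j` that involves the motion of the end-point `i`
  set g : Fin k → Fin k → ℝ := fun j i =>
    w i j * inner ℝ (q i - q j) (x.1 i) - w i j * dist (q i) (q j) * x.2 i with hg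
  have h1 : ∑ i, ∑ j ∈ Finset.Ioi i, w i j * edgeForm q i j x =
      ∑ i, ∑ j ∈ Finset.Ioi i, (g j i + g i j) := by
    refine Finset.sum_congr rfl fun i _ => Finset.sum_congr rfl fun j hj => ?_
    have hij : i ≠ j := (Finset.mem_Ioi.1 hj).ne
    simp only [hg, edgeForm]
    rw [← hsymm i j hij, dist_comm (q j) (q i), ← neg_sub (q i) (q j), inner_neg_left,
      inner_sub_right]
    ring
  rw [h1, Finset.sum_sum_Ioi_add_eq_sum_sum_off_diag, ← Finset.sum_add_distrib]
  refine Finset.sum_eq_zero fun i _ => ?_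
  simp only [hg]
  have h2 : ∑ j ∈ ({i} : Finset (Fin k))ᶜ, w i j * inner ℝ (q i - q j) (x.1 i) = 0 := by
    simp_rw [← real_inner_smul_left]
    rw [← sum_inner, heq i, inner_zero_left]
  rw [Finset.sum_sub_distrib, h2, ← Finset.sum_mul]
  ring

/-- If all edges but `i m` at `i` have nonnegative weight and the weights are in equilibrium at
`i`, then the weight of the mark is nonnegative, by the triangle inequality. -/
lemma mark_weight_nonneg {k : ℕ} (q : Fin k → Plane) (w : Fin k → Fin k → ℝ) (i m : Fin k)
    (heq : ∑ j ∈ ({i} : Finset (Fin k))ᶜ, w i j • (q i - q j) = 0)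
    (hw : ∀ j, j ≠ i → j ≠ m → 0 ≤ w i j) :
    0 ≤ ∑ j ∈ ({i} : Finset (Fin k))ᶜ, w i j * dist (q i) (q j) := by
  by_cases hm : m ≠ i ∧ w i m < 0
  · have hmem : m ∈ ({i} : Finset (Fin k))ᶜ := by simp [hm.1]
    rw [← Finset.add_sum_erase _ _ hmem] at heq ⊢
    have h1 : ‖w i m • (q i - q m)‖ =
        ‖∑ j ∈ (({i} : Finset (Fin k))ᶜ).erase m, w i j • (q i - q j)‖ := by
      rw [eq_neg_of_add_eq_zero_left heq, norm_neg]
    have h2 := norm_sum_le ((({i} : Finset (Fin k))ᶜ).erase m) fun j => w i j • (q i - q j)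
    rw [← h1, norm_smul, Real.norm_of_nonpos hm.2.le, ← dist_eq_norm] at h2
    have h3 : ∑ j ∈ (({i} : Finset (Fin k))ᶜ).erase m, ‖w i j • (q i - q j)‖ =
        ∑ j ∈ (({i} : Finset (Fin k))ᶜ).erase m, w i j * dist (q i) (q j) := by
      refine Finset.sum_congr rfl fun j hj => ?_
      simp only [Finset.mem_erase, Finset.mem_compl, Finset.mem_singleton] at hj
      rw [norm_smul, Real.norm_of_nonneg (hw j hj.2 hj.1), dist_eq_norm]
    rw [h3] at h2
    linarith
  · refine Finset.sum_nonneg fun j hj => mul_nonneg ?_ dist_nonneg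
    simp only [Finset.mem_compl, Finset.mem_singleton] at hj
    by_cases hjm : j = m
    · subst hjm
      by_contra h
      exact hm ⟨hj, not_le.1 h⟩
    · exact hw j hj hjm

variable {ι : Type*} {p : ι → Plane} {a b : ι} {f : Sym2 ι → ℝ} {f₀ : ι → ℝ} {x : Motion ι}

/-- A stress with positive stress sum has a negatively weighted edge or mark that is not tight. -/
lemma not_stressSum_pos {k : ℕ} {e : Fin k → ι} {w : Fin k → Fin k → ℝ} {α : Fin k → ℝ}
    (he : Function.Injective e) (hx : x ∈ expansionPolyhedron p a b f f₀)
    (hst : IsStress (p ∘ e) w α)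
    (hw : ∀ i j, i < j → 0 ≤ w i j ∨ edgeForm p (e i) (e j) x = f s(e i, e j))
    (hα : ∀ i, 0 ≤ α i ∨ x.2 (e i) = f₀ (e i)) : ¬ 0 < stressSum e w α f f₀ := by
  intro hpos
  have h0 := hst (fun i => x.1 (e i), fun i => x.2 (e i))
  have h1 : ∑ i, ∑ j ∈ Finset.Ioi i, w i j * f s(e i, e j) ≤ ∑ i, ∑ j ∈ Finset.Ioi i,
      w i j * edgeForm (p ∘ e) i j (fun i => x.1 (e i), fun i => x.2 (e i)) := by
    refine Finset.sum_le_sum fun i _ => Finset.sum_le_sum fun j hj => ?_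
    have hij := Finset.mem_Ioi.1 hj
    rcases hw i j hij with h | h
    · exact mul_le_mul_of_nonneg_left (hx.2.1 _ _ (he.ne hij.ne)) h
    · rw [← h]; rfl
  have h2 : ∑ i, α i * f₀ (e i) ≤ ∑ i, α i * x.2 (e i) := by
    refine Finset.sum_le_sum fun i _ => ?_
    rcases hα i with h | h
    · exact mul_le_mul_of_nonneg_left (hx.2.2 _) h
    · rw [h]
  unfold stressSum at hpos
  simp only at h0
  linarith

/-! ### Four points in general position -/

/-- The determinants of four points are proportional to the coefficients of an affine dependence
between them. -/
lemma det3_affine_dependence {x y z t : Plane} {α β γ δ : ℝ} (h0 : α + β + γ + δ = 0)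
    (h : α • x + β • y + γ • z + δ • t = 0) : γ * det3 x y z + δ * det3 x y t = 0 := by
  have hx := congrArg (fun v : Plane => v 0) h
  have hy := congrArg (fun v : Plane => v 1) h
  simp at hx hy
  obtain rfl : α = -(β + γ + δ) := by linarith
  simp only [det3_eq, det2, PiLp.sub_apply]
  linear_combination (y 0 - x 0) * hy - (y 1 - x 1) * hx

lemma det3_swap_right (x y z : Plane) : det3 x z y = -det3 x y z := by
  simp only [det3_eq, det2, PiLp.sub_apply]; ring

lemma det3_swap_left (x y z : Plane) : det3 y x z = -det3 x y z := by
  simp only [det3_eq, det2, PiLp.sub_apply]; ring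

/-- The weights `fourW` in terms of an affine dependence `μ` of the four points: each determinant is,
up to sign, a fixed multiple of the coefficient of the point that it omits. -/
lemma fourW_eq {q : Fin 4 → Plane} {μ : Fin 4 → ℝ} (hμ : ∀ i, μ i ≠ 0) (h0 : ∑ i, μ i = 0)
    (h1 : ∑ i, μ i • q i = 0) (hdet : det3 (q 0) (q 1) (q 2) ≠ 0) :
    GeneralPosition q ∧
    ∃ c : ℝ, 0 < c ∧ ∀ i j, i ≠ j → fourW q i j = -(c * (μ i * μ j * ∏ l, μ l)) := by
  rw [Fin.sum_univ_four] at h0 h1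
  obtain ⟨c, hc⟩ : ∃ c, det3 (q 0) (q 1) (q 2) = c * μ 3 :=
    ⟨det3 (q 0) (q 1) (q 2) / μ 3, by field_simp [hμ 3]⟩
  have hc0 : c ≠ 0 := by rintro rfl; simp [hc] at hdet
  have hb : det3 (q 0) (q 1) (q 3) = -(c * μ 2) := by
    have := det3_affine_dependence h0 h1
    rw [hc] at this
    exact mul_left_cancel₀ (hμ 3) (by linarith)
  have hd : det3 (q 0) (q 2) (q 3) = c * μ 1 := by
    have := det3_affine_dependence (x := q 0) (y := q 2) (z := q 1) (t := q 3)
      (by linarith : μ 0 + μ 2 + μ 1 + μ 3 = 0) (by rw [← h1]; abel)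
    rw [det3_swap_right, hc] at this
    exact mul_left_cancel₀ (hμ 3) (by linarith)
  have he : det3 (q 1) (q 2) (q 3) = -(c * μ 0) := by
    have := det3_affine_dependence (x := q 1) (y := q 2) (z := q 0) (t := q 3)
      (by linarith : μ 1 + μ 2 + μ 0 + μ 3 = 0) (by rw [← h1]; abel)
    rw [det3_swap_right, det3_swap_left, hc] at this
    exact mul_left_cancel₀ (hμ 3) (by linarith)
  have h021 := (det3_swap_right (q 0) (q 1) (q 2)).trans (congrArg _ hc)
  have h031 := (det3_swap_right (q 0) (q 1) (q 3)).trans (congrArg _ hb)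
  have h032 := (det3_swap_right (q 0) (q 2) (q 3)).trans (congrArg _ hd)
  have h132 := (det3_swap_right (q 1) (q 2) (q 3)).trans (congrArg _ he)
  have h102 := (det3_swap_left (q 0) (q 1) (q 2)).trans (congrArg _ hc)
  have h103 := (det3_swap_left (q 0) (q 1) (q 3)).trans (congrArg _ hb)
  have h203 := (det3_swap_left (q 0) (q 2) (q 3)).trans (congrArg _ hd)
  have h213 := (det3_swap_left (q 1) (q 2) (q 3)).trans (congrArg _ he)
  have h201 := (det3_swap_left (q 0) (q 2) (q 1)).trans (congrArg _ h021)
  have h301 := (det3_swap_left (q 0) (q 3) (q 1)).trans (congrArg _ h031)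
  have h302 := (det3_swap_left (q 0) (q 3) (q 2)).trans (congrArg _ h032)
  have h312 := (det3_swap_left (q 1) (q 3) (q 2)).trans (congrArg _ h132)
  have h120 := (det3_swap_right (q 1) (q 0) (q 2)).trans (congrArg _ h102)
  have h130 := (det3_swap_right (q 1) (q 0) (q 3)).trans (congrArg _ h103)
  have h230 := (det3_swap_right (q 2) (q 0) (q 3)).trans (congrArg _ h203)
  have h231 := (det3_swap_right (q 2) (q 1) (q 3)).trans (congrArg _ h213)
  have h210 := (det3_swap_right (q 2) (q 0) (q 1)).trans (congrArg _ h201)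
  have h310 := (det3_swap_right (q 3) (q 0) (q 1)).trans (congrArg _ h301)
  have h320 := (det3_swap_right (q 3) (q 0) (q 2)).trans (congrArg _ h302)
  have h321 := (det3_swap_right (q 3) (q 1) (q 2)).trans (congrArg _ h312)
  have m0 := hμ 0
  have m1 := hμ 1
  have m2 := hμ 2
  have m3 := hμ 3
  constructor
  · intro i j k hij hik hjk hcol
    have := det3_of_collinear hcol
    fin_cases i <;> fin_cases j <;> first | exact hij rfl | skip
    all_goals fin_cases k <;> first | exact hik rfl | exact hjk rfl | skip
    all_goals simp_all
  · refine ⟨(c * ∏ l, μ l)⁻¹ ^ 2, ?_, ?_⟩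
    · have : ∏ l, μ l ≠ 0 := Finset.prod_ne_zero_iff.2 fun l _ => hμ l
      positivity
    · have key : ∀ i j k l : Fin 4, k ≠ l → ({i, j} : Finset (Fin 4))ᶜ = {k, l} →
          ∏ m, μ m = μ i * μ j * (μ k * μ l) →
          det3 (q i) (q j) (q k) * det3 (q i) (q j) (q l) = -(c ^ 2 * (μ k * μ l)) →
          fourW q i j = -((c * ∏ l, μ l)⁻¹ ^ 2 * (μ i * μ j * ∏ l, μ l)) := by
        intro i j k l hkl hcompl hprod hdd
        rw [fourW, hcompl, Finset.prod_pair hkl, ← mul_inv, hdd, hprod]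
        have := hμ i
        have := hμ j
        have := hμ k
        have := hμ l
        field_simp
      intro i j hij
      fin_cases i <;> fin_cases j <;> first | exact absurd rfl hij | skip
      · exact key 0 1 2 3 (by decide) (by decide) (by rw [Fin.prod_univ_four]; ring)
          (by rw [hc, hb]; ring)
      · exact key 0 2 1 3 (by decide) (by decide) (by rw [Fin.prod_univ_four]; ring)
          (by rw [h021, hd]; ring)
      · exact key 0 3 1 2 (by decide) (by decide) (by rw [Fin.prod_univ_four]; ring)
          (by rw [h031, h032]; ring)
      · exact key 1 0 2 3 (by decide) (by decide) (by rw [Fin.prod_univ_four]; ring)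
          (by rw [h102, h103]; ring)
      · exact key 1 2 0 3 (by decide) (by decide) (by rw [Fin.prod_univ_four]; ring)
          (by rw [h120, he]; ring)
      · exact key 1 3 0 2 (by decide) (by decide) (by rw [Fin.prod_univ_four]; ring)
          (by rw [h130, h132]; ring)
      · exact key 2 0 1 3 (by decide) (by decide) (by rw [Fin.prod_univ_four]; ring)
          (by rw [h201, h203]; ring)
      · exact key 2 1 0 3 (by decide) (by decide) (by rw [Fin.prod_univ_four]; ring)
          (by rw [h210, h213]; ring)
      · exact key 2 3 0 1 (by decide) (by decide) (by rw [Fin.prod_univ_four]; ring)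
          (by rw [h230, h231]; ring)
      · exact key 3 0 1 2 (by decide) (by decide) (by rw [Fin.prod_univ_four]; ring)
          (by rw [h301, h302]; ring)
      · exact key 3 1 0 2 (by decide) (by decide) (by rw [Fin.prod_univ_four]; ring)
          (by rw [h310, h312]; ring)
      · exact key 3 2 0 1 (by decide) (by decide) (by rw [Fin.prod_univ_four]; ring)
          (by rw [h320, h321]; ring)

/-- Four points with affine dependence `μ`: some edge or mark of negative weight is not tight.
The weight of `i j` has the sign of `-μ i * μ j * ∏ l, μ l`. -/
lemma four_points_not_tight {e : Fin 4 → ι} {μ : Fin 4 → ℝ} (h4 : FourPointInequalities p f f₀)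
    (hx : x ∈ expansionPolyhedron p a b f f₀) (hμ : ∀ i, μ i ≠ 0) (h0 : ∑ i, μ i = 0)
    (h1 : ∑ i, μ i • p (e i) = 0) (hdet : det3 (p (e 0)) (p (e 1)) (p (e 2)) ≠ 0)
    (hw : ∀ i j, i < j → μ i * μ j * ∏ l, μ l ≤ 0 ∨ edgeForm p (e i) (e j) x = f s(e i, e j))
    (hα : ∀ i, (∃ m, ∀ j, j ≠ i → j ≠ m → μ i * μ j * ∏ l, μ l ≤ 0) ∨ x.2 (e i) = f₀ (e i)) :
    False := by
  obtain ⟨hgp, c, hc, hW⟩ := fourW_eq (q := p ∘ e) hμ h0 h1 hdet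
  have he : Function.Injective e := by
    intro i j hij
    by_contra hne
    obtain ⟨k, hik, hjk⟩ : ∃ k, i ≠ k ∧ j ≠ k := by clear hij; revert i j; decide
    refine hgp i j k hne hik hjk ?_
    simp only [Function.comp, hij, Set.mem_singleton_iff, Set.insert_eq_of_mem,
      Set.mem_insert_iff, true_or]
    exact collinear_pair ℝ _ _
  have hsum : ∀ i : Fin 4, ∑ j ∈ ({i} : Finset (Fin 4))ᶜ,
      fourW (p ∘ e) i j • ((p ∘ e) i - (p ∘ e) j) = 0 := by
    intro i
    have hterm : ∀ j ∈ ({i} : Finset (Fin 4))ᶜ, fourW (p ∘ e) i j • ((p ∘ e) i - (p ∘ e) j) =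
        -(c * μ i * ∏ l, μ l) • (μ j • (p (e i) - p (e j))) := by
      intro j hj
      rw [hW i j (by simpa [eq_comm] using hj), smul_smul]
      congr 1; ring
    rw [Finset.sum_congr rfl hterm, ← Finset.smul_sum]
    have hall : ∑ j ∈ ({i} : Finset (Fin 4))ᶜ, μ j • (p (e i) - p (e j)) =
        ∑ j, μ j • (p (e i) - p (e j)) := by
      refine Finset.sum_subset (Finset.subset_univ _) fun j _ hj => ?_
      have : j = i := by simpa using hj
      simp [this]
    rw [hall]
    simp_rw [smul_sub]
    rw [Finset.sum_sub_distrib, ← Finset.sum_smul, h0, h1]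
    simp
  have hsgn : ∀ i j, i ≠ j → μ i * μ j * ∏ l, μ l ≤ 0 → 0 ≤ fourW (p ∘ e) i j := by
    intro i j hij h
    rw [hW i j hij]
    nlinarith
  refine not_stressSum_pos he hx (isStress_of_equilibrium _ _ ?_ hsum) ?_ ?_ (h4 e hgp)
  · intro i j hij
    rw [hW i j hij, hW j i hij.symm]; ring
  · intro i j hij
    exact (hw i j hij).imp_left (hsgn i j hij.ne)
  · intro i
    refine (hα i).imp_left ?_
    rintro ⟨m, hm⟩
    exact mark_weight_nonneg _ _ i m (hsum i) fun j hji hjm => hsgn i j hji.symm (hm j hji hjm)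

/-- No point of the polyhedron is tight on two edges that cross properly. -/
lemma not_tight_of_crossing (h4 : FourPointInequalities p f f₀)
    (hx : x ∈ expansionPolyhedron p a b f f₀) {i j k l : ι} {s r : ℝ} (hs0 : 0 < s) (hs1 : s < 1)
    (hr0 : 0 < r) (hr1 : r < 1) (hdet : det2 (p j - p i) (p l - p k) ≠ 0)
    (h : p i + s • (p j - p i) = p k + r • (p l - p k))
    (hij : edgeForm p i j x = f s(i, j)) (hkl : edgeForm p k l x = f s(k, l)) : False := by
  obtain ⟨S, hS⟩ : ∃ S, S = 1 - s := ⟨_, rfl⟩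
  obtain ⟨R, hR⟩ : ∃ R, R = 1 - r := ⟨_, rfl⟩
  have hS0 : 0 < S := by linarith
  have hR0 : 0 < R := by linarith
  have hprod : 0 < ∏ l, (![S, -R, s, -r] : Fin 4 → ℝ) l := by
    simp only [Fin.prod_univ_four, Matrix.cons_val]
    have : 0 < S * R * s * r := by positivity
    linarith
  have hneg : ∀ m n : Fin 4, n ≠ m → n ≠ m + 2 →
      (![S, -R, s, -r] : Fin 4 → ℝ) m * (![S, -R, s, -r] : Fin 4 → ℝ) n *
        ∏ l, (![S, -R, s, -r] : Fin 4 → ℝ) l ≤ 0 := by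
    intro m n hn hn'
    refine mul_nonpos_of_nonpos_of_nonneg ?_ hprod.le
    have := mul_pos hS0 hR0
    have := mul_pos hS0 hr0
    have := mul_pos hs0 hR0
    have := mul_pos hs0 hr0
    fin_cases m <;> fin_cases n <;> simp at hn hn' ⊢ <;> linarith
  -- the affine dependence equates the two expressions for the crossing point
  refine four_points_not_tight (e := ![i, k, j, l]) (μ := ![S, -R, s, -r]) h4 hx
    ?_ ?_ ?_ ?_ ?_ fun m => Or.inl ⟨m + 2, hneg m⟩
  · intro m
    fin_cases m <;> simp <;> linarith
  · simp only [Fin.sum_univ_four, Matrix.cons_val]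
    linarith
  · have : p i + s • (p j - p i) - (p k + r • (p l - p k)) = 0 := sub_eq_zero.2 h
    simp only [Fin.sum_univ_four, Matrix.cons_val]
    rw [← this, hS, hR]; module
  · simp only [Matrix.cons_val]
    intro h3
    apply hdet
    have hk : p k = p i + s • (p j - p i) - r • (p l - p k) := by rw [h]; abel
    have h5 : r * det2 (p j - p i) (p l - p k) = det3 (p i) (p k) (p j) := by
      rw [det3_eq]
      have : p k - p i = s • (p j - p i) - r • (p l - p k) := by
        nth_rw 1 [hk]; abel
      rw [this]
      simp [det2]; ring
    rw [h3] at h5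
    simpa [hr0.ne'] using h5
  · intro m n hmn
    by_cases hn : n = m + 2
    · right
      fin_cases m <;> simp at hn <;> subst hn
      · exact hij
      · exact hkl
      · simp at hmn
      · simp at hmn
    · exact Or.inl (hneg m n hmn.ne' hn)

/-- No point of the polyhedron is tight on the mark of a point `c` inside a triangle and on the
three edges from `c` to its vertices. -/
lemma not_tight_of_triangle (h4 : FourPointInequalities p f f₀)
    (hx : x ∈ expansionPolyhedron p a b f f₀) {i j k c : ι}
    (h1 : 0 < det2 (p i - p c) (p j - p c)) (h2 : 0 < det2 (p j - p c) (p k - p c))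
    (h3 : 0 < det2 (p k - p c) (p i - p c)) (hi : edgeForm p i c x = f s(i, c))
    (hj : edgeForm p j c x = f s(j, c)) (hk : edgeForm p k c x = f s(k, c))
    (hc : x.2 c = f₀ c) : False := by
  -- the barycentric coordinates of `p c`, up to a factor, by Cramer's rule
  set A := det2 (p j - p c) (p k - p c) with hA
  set B := det2 (p k - p c) (p i - p c) with hB
  set C := det2 (p i - p c) (p j - p c) with hC
  have hprod : ∏ l, (![A, B, C, -(A + B + C)] : Fin 4 → ℝ) l < 0 := by
    have : 0 < A * B * C * (A + B + C) := by positivity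
    simp only [Fin.prod_univ_four, Matrix.cons_val]
    linarith
  refine four_points_not_tight (e := ![i, j, k, c]) (μ := ![A, B, C, -(A + B + C)]) h4 hx
    ?_ ?_ ?_ ?_ ?_ ?_
  · intro m
    fin_cases m <;> simp <;> linarith
  · simp [Fin.sum_univ_four]
  · simp only [Fin.sum_univ_four, Matrix.cons_val]
    apply plane_ext <;> simp [hA, hB, hC, det2] <;> ring
  · simp only [Matrix.cons_val]
    have : det3 (p i) (p j) (p k) = A + B + C := by
      rw [det3_eq]; simp [hA, hB, hC, det2]; ring
    rw [this]; positivity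
  · intro m n hmn
    have hAB := mul_pos h2 h3
    have hAC := mul_pos h2 h1
    have hBC := mul_pos h3 h1
    by_cases hn : n = 3
    · right
      subst hn
      fin_cases m
      · exact hi
      · exact hj
      · exact hk
      · simp at hmn
    · left
      refine mul_nonpos_of_nonneg_of_nonpos ?_ hprod.le
      fin_cases m <;> fin_cases n <;> simp at hmn hn ⊢ <;> positivity
  · intro m
    by_cases hm : m = 3
    · subst hm; exact Or.inr hc
    · refine Or.inl ⟨3, fun n hn hn' => mul_nonpos_of_nonneg_of_nonpos ?_ hprod.le⟩
      fin_cases m <;> fin_cases n <;> simp at hm hn hn' ⊢ <;> positivity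

end Stress

/-! ### Betweenness -/

section Betweenness

lemma sbtw_iff_exists {x y z : Plane} :
    Sbtw ℝ x y z ↔ x ≠ z ∧ ∃ t : ℝ, 0 < t ∧ t < 1 ∧ y = x + t • (z - x) := by
  rw [sbtw_iff_mem_image_Ioo_and_ne, and_comm]
  refine and_congr_right fun _ => ⟨?_, ?_⟩
  · rintro ⟨t, ht, rfl⟩
    exact ⟨t, ht.1, ht.2, by rw [AffineMap.lineMap_apply_module']; abel⟩
  · rintro ⟨t, h0, h1, rfl⟩
    exact ⟨t, ⟨h0, h1⟩, by rw [AffineMap.lineMap_apply_module']; abel⟩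

lemma sbtw_iff_opposite {x y z : Plane} :
    Sbtw ℝ x y z ↔ y ≠ z ∧ ∃ r : ℝ, 0 < r ∧ x - y = (-r) • (z - y) := by
  rw [sbtw_iff_exists]
  constructor
  · rintro ⟨hne, t, h0, h1, rfl⟩
    have h1' : 0 < 1 - t := by linarith
    have hz : z - (x + t • (z - x)) = (1 - t) • (z - x) := by module
    refine ⟨fun h => ?_, t / (1 - t), by positivity, ?_⟩
    · rw [h, sub_self, eq_comm, smul_eq_zero] at hz
      exact hz.elim (fun h => h1'.ne' (by linarith)) fun h => hne (sub_eq_zero.1 h).symm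
    · rw [hz, smul_smul, neg_mul, div_mul_cancel₀ _ h1'.ne']
      module
  · rintro ⟨hne, r, hr, h⟩
    obtain rfl : x = y + (-r) • (z - y) := by rw [← h]; abel
    have hz : z - (y + (-r) • (z - y)) = (1 + r) • (z - y) := by module
    have hr' : 0 < 1 + r := by linarith
    refine ⟨fun h => ?_, r / (1 + r), by positivity, by rw [div_lt_one hr']; linarith, ?_⟩
    · rw [h, sub_self, eq_comm, smul_eq_zero] at hz
      exact hz.elim (fun h => hr'.ne' (by linarith)) fun h => hne (sub_eq_zero.1 h).symm
    · rw [hz, smul_smul, div_mul_cancel₀ _ hr'.ne']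
      module

/-- Of two points strictly between `x` and `z`, the second lies on one side of the first. -/
lemma sbtw_or_sbtw {x y z w : Plane} (hy : Sbtw ℝ x y z) (hw : Sbtw ℝ x w z) (hne : w ≠ y) :
    Sbtw ℝ x w y ∨ Sbtw ℝ y w z := by
  obtain ⟨hxz, s, hs0, hs1, rfl⟩ := sbtw_iff_exists.1 hy
  obtain ⟨-, t, ht0, ht1, rfl⟩ := sbtw_iff_exists.1 hw
  rcases lt_trichotomy t s with h | h | h
  · left
    refine sbtw_iff_exists.2 ⟨hy.left_ne, t / s, by positivity, by rwa [div_lt_one hs0], ?_⟩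
    rw [add_sub_cancel_left, smul_smul, div_mul_cancel₀ _ hs0.ne']
  · exact absurd (by rw [h]) hne
  · right
    have h1 : 0 < 1 - s := by linarith
    refine sbtw_iff_exists.2 ⟨hy.ne_right, (t - s) / (1 - s), div_pos (by linarith) h1,
      by rw [div_lt_one h1]; linarith, ?_⟩
    have hz : z - (x + s • (z - x)) = (1 - s) • (z - x) := by module
    rw [hz, smul_smul, div_mul_cancel₀ _ h1.ne']
    module

end Betweenness

section Graph

variable {ι : Type*} {p : ι → Plane} {a b : ι} {f : Sym2 ι → ℝ} {f₀ : ι → ℝ} {x : Motion ι}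

/-! ### The stress of a wheel -/

/-- No point of the polyhedron is tight on the mark of the crossing point `c` of two diagonals and
on the four edges from `c` to the vertices of the quadrilateral. -/
lemma not_tight_of_cross (h5 : FivePointInequalities p f f₀)
    (hx : x ∈ expansionPolyhedron p a b f f₀) {i j k l c : ι} {r s : ℝ} (hr : 0 < r) (hs : 0 < s)
    (hdet : 0 < det2 (p i - p c) (p j - p c)) (hk : p k - p c = (-r) • (p i - p c))
    (hl : p l - p c = (-s) • (p j - p c)) (hi : edgeForm p i c x = f s(i, c))
    (hj : edgeForm p j c x = f s(j, c)) (hk' : edgeForm p k c x = f s(k, c))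
    (hl' : edgeForm p l c x = f s(l, c)) (hc : x.2 c = f₀ c) : False := by
  -- the determinants with the two half-diagonals tell the five points apart
  have he : Function.Injective ![i, j, k, l, c] := by
    set D := det2 (p i - p c) (p j - p c) with hD
    have hself : ∀ d, det2 d d = 0 := fun d => by simp only [det2]; ring
    have h0 : ∀ d, det2 d (p c - p c) = 0 := fun d => by simp [det2]
    have hji : det2 (p j - p c) (p i - p c) = -D := det2_swap _ _
    have h1 : ∀ m, det2 (p i - p c) (p (![i, j, k, l, c] m) - p c) =
        (![0, D, 0, -(s * D), 0] : Fin 5 → ℝ) m := by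
      intro m
      fin_cases m
      · exact hself _
      · rfl
      · show det2 _ (p k - p c) = 0
        rw [hk, det2_smul_right, hself, mul_zero]
      · show det2 _ (p l - p c) = -(s * D)
        rw [hl, det2_smul_right]; ring
      · exact h0 _
    have h2 : ∀ m, det2 (p j - p c) (p (![i, j, k, l, c] m) - p c) =
        (![-D, 0, r * D, 0, 0] : Fin 5 → ℝ) m := by
      intro m
      fin_cases m
      · exact hji
      · exact hself _
      · show det2 _ (p k - p c) = r * D
        rw [hk, det2_smul_right, hji]; ring
      · show det2 _ (p l - p c) = 0
        rw [hl, det2_smul_right, hself, mul_zero]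
      · exact h0 _
    intro m n hmn
    have e1 := h1 m
    have e2 := h2 m
    rw [hmn, h1 n] at e1
    rw [hmn, h2 n] at e2
    have hp1 := mul_pos hr hdet
    have hp2 := mul_pos hs hdet
    clear_value D
    clear h1 h2 hmn
    fin_cases m <;> fin_cases n <;> first | rfl | skip
    all_goals
      simp only [Fin.reduceFinMk, Fin.zero_eta, Fin.mk_one, Matrix.cons_val] at e1 e2
      linarith
  have hE : p i - p c ≠ 0 := fun h => by rw [h] at hdet; simp [det2] at hdet
  have hG : p j - p c ≠ 0 := fun h => by rw [h] at hdet; simp [det2] at hdet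
  have hquad : IsCrossedQuadrilateral (p ∘ ![i, j, k, l, c]) := by
    refine ⟨Sbtw.symm ?_, Sbtw.symm ?_, fun h => ?_⟩
    · exact sbtw_iff_opposite.2 ⟨(sub_ne_zero.1 hE).symm, r, hr, hk⟩
    · exact sbtw_iff_opposite.2 ⟨(sub_ne_zero.1 hG).symm, s, hs, hl⟩
    · have h1 : det3 (p i) (p j) (p c) = 0 := det3_of_collinear h
      have h2 : det3 (p i) (p j) (p c) = det2 (p i - p c) (p j - p c) := by
        simp only [det3_eq, det2, PiLp.sub_apply]; ring
      linarith
  -- a side between vertices at distances `u`, `v` along the half-diagonals, measured in units of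
  -- `p i - p c` and `p j - p c`, has weight `r * s / (u * v)`; equilibrium determines the spokes
  set w : Fin 5 → Fin 5 → ℝ := ![![0, r * s, 0, r, -(r * s + r)], ![r * s, 0, s, 0, -(r * s + s)],
    ![0, s, 0, 1, -(s + 1)], ![r, 0, 1, 0, -(r + 1)],
    ![-(r * s + r), -(r * s + s), -(s + 1), -(r + 1), 0]] with hw
  have hpk : p k = p c + (-r) • (p i - p c) := by rw [← hk]; abel
  have hpl : p l = p c + (-s) • (p j - p c) := by rw [← hl]; abel
  have c0 : ({0} : Finset (Fin 5))ᶜ = {1, 2, 3, 4} := by decide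
  have c1 : ({1} : Finset (Fin 5))ᶜ = {0, 2, 3, 4} := by decide
  have c2 : ({2} : Finset (Fin 5))ᶜ = {0, 1, 3, 4} := by decide
  have c3 : ({3} : Finset (Fin 5))ᶜ = {0, 1, 2, 4} := by decide
  have c4 : ({4} : Finset (Fin 5))ᶜ = {0, 1, 2, 3} := by decide
  have hsymm : ∀ m n, m ≠ n → w m n = w n m := by
    intro m n _
    fin_cases m <;> fin_cases n <;> rfl
  have heq : ∀ m, ∑ n ∈ ({m} : Finset (Fin 5))ᶜ,
      w m n • ((p ∘ ![i, j, k, l, c]) m - (p ∘ ![i, j, k, l, c]) n) = 0 := by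
    intro m
    fin_cases m
    · simp [c0, hw, hpk, hpl]; module
    · simp [c1, hw, hpk, hpl]; module
    · simp [c2, hw, hpk, hpl]; module
    · simp [c3, hw, hpk, hpl]; module
    · simp [c4, hw, hpk, hpl]; module
  have hrs := mul_pos hr hs
  have hsign : HasWheelSigns w fun m => ∑ n ∈ ({m} : Finset (Fin 5))ᶜ,
      w m n * dist ((p ∘ ![i, j, k, l, c]) m) ((p ∘ ![i, j, k, l, c]) n) := by
    refine ⟨⟨hrs, hs, one_pos, hr⟩, ⟨rfl, rfl⟩, ⟨?_, ?_, ?_, ?_⟩, ⟨?_, ?_, ?_, ?_, ?_⟩⟩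
    · simp [hw]; linarith
    · simp [hw]; linarith
    · simp [hw]; linarith
    · simp [hw]; linarith
    · have h := mul_norm_lt_of_smul_add_smul_eq (x := p i - p j) (y := p i - p l)
        (z := p i - p c) hrs hr (by linarith : 0 < r * s + r)
        (by
          rw [show p i - p l = p i - p c + s • (p j - p c) by rw [hpl]; module,
            show p i - p j = (p i - p c) - (p j - p c) by abel]
          have : det2 (p i - p c - (p j - p c)) (p i - p c + s • (p j - p c)) =
            (1 + s) * det2 (p i - p c) (p j - p c) := by simp [det2]; ring
          rw [this]; positivity)
        (by rw [hpl]; module)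
      simp [c0, hw, dist_eq_norm]; linarith
    · have h := mul_norm_lt_of_smul_add_smul_eq (x := p j - p i) (y := p j - p k)
        (z := p j - p c) hrs hs (by linarith : 0 < r * s + s)
        (by
          rw [show p j - p k = p j - p c + r • (p i - p c) by rw [hpk]; module,
            show p j - p i = (p j - p c) - (p i - p c) by abel]
          have : det2 (p j - p c - (p i - p c)) (p j - p c + r • (p i - p c)) =
            -((1 + r) * det2 (p i - p c) (p j - p c)) := by simp [det2]; ring
          rw [this]; exact neg_ne_zero.2 (by positivity))
        (by rw [hpk]; module)
      simp [c1, hw, dist_eq_norm]; linarith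
    · have h := mul_norm_lt_of_smul_add_smul_eq (x := p k - p j) (y := p k - p l)
        (z := p k - p c) hs one_pos (by linarith : 0 < s + 1)
        (by
          rw [show p k - p j = (-r) • (p i - p c) - (p j - p c) by rw [hpk]; module,
            show p k - p l = (-r) • (p i - p c) + s • (p j - p c) by rw [hpk, hpl]; module]
          have : det2 ((-r) • (p i - p c) - (p j - p c)) ((-r) • (p i - p c) + s • (p j - p c)) =
            -((r * s + r) * det2 (p i - p c) (p j - p c)) := by simp [det2]; ring
          rw [this]; exact neg_ne_zero.2 (by positivity))
        (by rw [hpk, hpl]; module)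
      simp [c2, hw, dist_eq_norm]; linarith
    · have h := mul_norm_lt_of_smul_add_smul_eq (x := p l - p i) (y := p l - p k)
        (z := p l - p c) hr one_pos (by linarith : 0 < r + 1)
        (by
          rw [show p l - p i = (-s) • (p j - p c) - (p i - p c) by rw [hpl]; module,
            show p l - p k = (-s) • (p j - p c) + r • (p i - p c) by rw [hpk, hpl]; module]
          have : det2 ((-s) • (p j - p c) - (p i - p c)) ((-s) • (p j - p c) + r • (p i - p c)) =
            (r * s + s) * det2 (p i - p c) (p j - p c) := by simp [det2]; ring
          rw [this]; positivity)
        (by rw [hpk, hpl]; module)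
      simp [c3, hw, dist_eq_norm]; linarith
    · have h1 : 0 < ‖p c - p i‖ := norm_pos_iff.2 fun h => hE (by rw [← neg_sub, h, neg_zero])
      have h2 := norm_nonneg (p c - p j)
      have h3 := norm_nonneg (p c - p k)
      have h4 := norm_nonneg (p c - p l)
      simp [c4, hw, dist_eq_norm]
      nlinarith [mul_pos (by linarith : 0 < r * s + r) h1,
        mul_nonneg (by linarith : 0 ≤ r * s + s) h2,
        mul_nonneg (by linarith : 0 ≤ s + 1) h3, mul_nonneg (by linarith : 0 ≤ r + 1) h4]
  have hst := isStress_of_equilibrium _ w hsymm heq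
  refine not_stressSum_pos he hx hst ?_ ?_ (h5 _ hquad _ _ hst hsign)
  · intro m n hmn
    by_cases hn : n = 4
    · right
      subst hn
      fin_cases m
      · exact hi
      · exact hj
      · exact hk'
      · exact hl'
      · simp at hmn
    · left
      fin_cases m <;> fin_cases n <;> simp [hw] at hmn hn ⊢ <;> positivity
  · intro m
    obtain ⟨-, -, -, h0, h1, h2, h3, -⟩ := hsign
    fin_cases m
    · exact Or.inl h0.le
    · exact Or.inl h1.le
    · exact Or.inl h2.le
    · exact Or.inl h3.le
    · exact Or.inr hc

/-! ### Tight graphs are non-crossing -/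

/-- If two edges overlap in a segment and no edge contains a further point of the set, then their
end-points agree. -/
lemma eq_endpoint_of_overlap (hp : Function.Injective p) {G : SimpleGraph ι}
    (hG : ∀ i j k, G.Adj i j → p k ∈ segment ℝ (p i) (p j) → k = i ∨ k = j) {i j k l : ι}
    (hij : G.Adj i j) (hkl : G.Adj k l) {s r m : ℝ} (hs0 : 0 < s) (hs1 : s < 1) (hr0 : 0 < r)
    (hr1 : r < 1) (hm : p l - p k = m • (p j - p i))
    (h : p i + s • (p j - p i) = p k + r • (p l - p k)) : k = i ∨ k = j := by
  have hD : p j - p i ≠ 0 := sub_ne_zero.2 (hp.ne hij.ne')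
  have hm0 : m ≠ 0 := by
    rintro rfl
    rw [zero_smul] at hm
    exact hkl.ne' (hp (sub_eq_zero.1 hm))
  -- positions of `p k` and `p l` on the line, with `p i` at `0`, `p j` at `1`; they lie on
  -- different sides of `s`
  have hk : p k = p i + (s - r * m) • (p j - p i) := by
    rw [hm] at h
    rw [← add_sub_cancel_right (p k) (r • m • (p j - p i)), ← h]; module
  have hl : p l = p i + (s + (1 - r) * m) • (p j - p i) := by
    rw [← sub_add_cancel (p l) (p k), hm, hk]; module
  have hcoef : ∀ {t t' : ℝ}, p i + t • (p j - p i) = p i + t' • (p j - p i) → t = t' :=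
    fun h => smul_left_injective ℝ hD (add_left_cancel h)
  have hrm : (1 - r) * m + r * m = m := by ring
  rcases lt_or_ge (s - r * m) 0 with h1 | h1
  · have hrm0 : 0 < r * m := by linarith
    have hmpos : 0 < m := pos_of_mul_pos_right hrm0 hr0.le
    have hτ : 0 < (1 - r) * m := mul_pos (by linarith) hmpos
    rcases hG k l i hkl (by
      rw [segment_eq_image']
      refine ⟨-(s - r * m) / m, ⟨div_nonneg (by linarith) hmpos.le, ?_⟩, ?_⟩
      · rw [div_le_one hmpos]; linarith
      · simp only
        rw [hm, smul_smul, div_mul_cancel₀ _ hm0, hk]; module) with h2 | h2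
    · exact Or.inl h2.symm
    · subst h2
      have := hcoef (t := 0) (by rw [← hl]; simp)
      linarith
  rcases le_or_gt (s - r * m) 1 with h2 | h2
  · exact hG i j k hij (by rw [segment_eq_image']; exact ⟨_, ⟨h1, h2⟩, hk.symm⟩)
  · have hrm0 : r * m < 0 := by linarith
    have hmneg : m < 0 := by
      by_contra hcon
      exact absurd (mul_nonneg hr0.le (not_lt.1 hcon)) (not_le.2 hrm0)
    have hτ : (1 - r) * m < 0 := mul_neg_of_pos_of_neg (by linarith) hmneg
    rcases hG k l j hkl (by
      rw [segment_eq_image']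
      refine ⟨(1 - (s - r * m)) / m, ⟨div_nonneg_of_nonpos (by linarith) hmneg.le, ?_⟩, ?_⟩
      · rw [div_le_one_of_neg hmneg]; linarith
      · simp only
        rw [hm, smul_smul, div_mul_cancel₀ _ hm0, hk]; module) with h3 | h3
    · exact Or.inr h3.symm
    · subst h3
      have := hcoef (t := 1) (t' := s + (1 - r) * m) (by rw [← hl]; module)
      linarith

/-- The graph of edges and marks tight at a point of the polyhedron is non-crossing as soon as no
edge of it contains a further point of the set. -/
lemma nonCrossing_of_tight [Fintype ι] (hp : Function.Injective p)
    (hA : NoThreeCollinearBoundary p) (h4 : FourPointInequalities p f f₀)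
    (h5 : FivePointInequalities p f f₀) (hx : x ∈ expansionPolyhedron p a b f f₀)
    {T : MarkedGraph ι} (hT : ∀ i j, T.graph.Adj i j → edgeForm p i j x = f s(i, j))
    (hM : ∀ i ∈ T.marks, x.2 i = f₀ i)
    (hbtw : ∀ i j k, T.graph.Adj i k → ¬ Sbtw ℝ (p i) (p j) (p k)) : T.NonCrossing p := by
  have h1 : ∀ i j k, T.graph.Adj i j → p k ∈ segment ℝ (p i) (p j) → k = i ∨ k = j := by
    intro i j k hij hk
    by_contra hcon
    push Not at hcon
    exact hbtw i k j hij ⟨mem_segment_iff_wbtw.1 hk, hp.ne hcon.1, hp.ne hcon.2⟩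
  refine ⟨⟨h1, ?_⟩, ?_⟩
  · intro i j k l hij hkl hne y hy hy'
    have hend : y = p i ∨ y = p j → y = p k ∨ y = p l := by
      rintro (rfl | rfl)
      · exact (h1 k l i hkl hy').imp (congrArg p) (congrArg p)
      · exact (h1 k l j hkl hy').imp (congrArg p) (congrArg p)
    have hend' : y = p k ∨ y = p l → y = p i ∨ y = p j := by
      rintro (rfl | rfl)
      · exact (h1 i j k hij hy).imp (congrArg p) (congrArg p)
      · exact (h1 i j l hij hy).imp (congrArg p) (congrArg p)
    by_contra hcon
    have hyij : ¬ (y = p i ∨ y = p j) := fun h => hcon ⟨h, hend h⟩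
    have hykl : ¬ (y = p k ∨ y = p l) := fun h => hcon ⟨hend' h, h⟩
    push Not at hyij hykl
    rw [segment_eq_image'] at hy hy'
    obtain ⟨s, hs, hys⟩ := hy
    obtain ⟨r, hr, hyr⟩ := hy'
    simp only at hys hyr
    have hs0 : 0 < s := lt_of_le_of_ne hs.1 (by rintro rfl; simp [eq_comm, hyij.1] at hys)
    have hs1 : s < 1 := lt_of_le_of_ne hs.2 (by rintro rfl; simp [eq_comm, hyij.2] at hys)
    have hr0 : 0 < r := lt_of_le_of_ne hr.1 (by rintro rfl; simp [eq_comm, hykl.1] at hyr)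
    have hr1 : r < 1 := lt_of_le_of_ne hr.2 (by rintro rfl; simp [eq_comm, hykl.2] at hyr)
    have heq := hys.trans hyr.symm
    by_cases hdet : det2 (p j - p i) (p l - p k) = 0
    · obtain ⟨m, hm⟩ := exists_eq_smul_of_det2_eq_zero (sub_ne_zero.2 (hp.ne hij.ne')) hdet
      have hk := eq_endpoint_of_overlap hp h1 hij hkl hs0 hs1 hr0 hr1 hm heq
      have hl := eq_endpoint_of_overlap hp h1 hij hkl.symm hs0 hs1 (by linarith : 0 < 1 - r)
        (by linarith) (m := -m) (by rw [neg_smul, ← hm]; abel) (by rw [heq]; module)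
      have hkl' := hkl.ne
      apply hne
      rcases hk with rfl | rfl <;> rcases hl with rfl | rfl
      · exact absurd rfl hkl'
      · rfl
      · exact Sym2.eq_swap
      · exact absurd rfl hkl'
    · exact not_tight_of_crossing h4 hx hs0 hs1 hr0 hr1 hdet heq (hT i j hij) (hT k l hkl)
  · intro c hc
    by_cases hint : p c ∈ interior (hull p)
    · right; right
      refine ⟨hint, ?_⟩
      by_contra hcon
      push Not at hcon
      classical
      have hadj : ∀ {i}, i ∈ Finset.univ.filter (T.graph.Adj c) →
          edgeForm p i c x = f s(i, c) := fun h => hT _ _ (Finset.mem_filter.1 h).2.symm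
      rcases exists_triangle_or_cross (Finset.univ.filter (T.graph.Adj c)) (fun i => p i - p c)
        (fun i hi => sub_ne_zero.2 (hp.ne (Finset.mem_filter.1 hi).2.ne'))
        (fun u hu => by
          obtain ⟨j, hj, hlt⟩ := hcon u hu
          exact ⟨j, by simpa using hj, hlt⟩) with
        ⟨i, hi, j, hj, k, hk, d1, d2, d3⟩ |
        ⟨i, hi, j, hj, k, hk, l, hl, hdet, ⟨r, hr, hkr⟩, s, hs, hls⟩
      · exact not_tight_of_triangle h4 hx d1 d2 d3 (hadj hi) (hadj hj) (hadj hk) (hM c hc)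
      · exact not_tight_of_cross h5 hx hr hs hdet hkr hls (hadj hi) (hadj hj) (hadj hk) (hadj hl)
          (hM c hc)
    · exact Or.inl (mem_extremePoints_of_not_mem_interior hp hA hint)

end Graph

section Polyhedron

variable {ι : Type*} {p : ι → Plane} {a b : ι} {f : Sym2 ι → ℝ} {f₀ : ι → ℝ} {x : Motion ι}

/-! ### Collinear triples -/

/-- The stress of a collinear triple, as a relation between the slacks of its edges and of the mark
of its middle point. -/
lemma slack_collinear {i j k : ι} (h : Sbtw ℝ (p i) (p j) (p k)) (x : Motion ι) :
    (edgeForm p i k x - f s(i, k)) / dist (p i) (p k) =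
      (edgeForm p i j x - f s(i, j)) / dist (p i) (p j) +
      (edgeForm p j k x - f s(j, k)) / dist (p j) (p k) + 2 * (x.2 j - f₀ j) +
      tripleSum p f f₀ i j k := by
  obtain ⟨hjk, r, hr, hij⟩ := sbtw_iff_opposite.1 h
  have hN : 0 < ‖p k - p j‖ := norm_pos_iff.2 (sub_ne_zero.2 hjk.symm)
  have hik : p i - p k = (-(1 + r)) • (p k - p j) := by
    rw [← sub_add_sub_cancel (p i) (p j) (p k), hij]; module
  have hjk' : p j - p k = (-1 : ℝ) • (p k - p j) := by module
  have hr' : 0 < 1 + r := by linarith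
  have d1 : dist (p i) (p j) = r * ‖p k - p j‖ := by
    rw [dist_eq_norm, hij, norm_smul, norm_neg, Real.norm_of_nonneg hr.le]
  have d2 : dist (p i) (p k) = (1 + r) * ‖p k - p j‖ := by
    rw [dist_eq_norm, hik, norm_smul, norm_neg, Real.norm_of_nonneg hr'.le]
  have d3 : dist (p j) (p k) = ‖p k - p j‖ := by rw [dist_comm, dist_eq_norm]
  simp only [tripleSum, edgeForm, d1, d2, d3]
  rw [hij, hik, hjk']
  simp only [real_inner_smul_left, inner_sub_right]
  field_simp
  ring

/-- If the long edge of a collinear triple is tight, then so are the two short edges and the mark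
of the middle point. -/
lemma tight_of_collinear {i j k : ι} (h : Sbtw ℝ (p i) (p j) (p k))
    (h3 : 0 ≤ tripleSum p f f₀ i j k) (hx : x ∈ expansionPolyhedron p a b f f₀)
    (hik : edgeForm p i k x = f s(i, k)) :
    edgeForm p i j x = f s(i, j) ∧ edgeForm p j k x = f s(j, k) ∧ x.2 j = f₀ j ∧
      tripleSum p f f₀ i j k = 0 := by
  have hne1 : i ≠ j := fun e => h.left_ne (congrArg p e)
  have hne2 : j ≠ k := fun e => h.ne_right (congrArg p e)
  have hd1 : 0 < dist (p i) (p j) := dist_pos.2 h.left_ne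
  have hd2 : 0 < dist (p j) (p k) := dist_pos.2 h.ne_right
  have hs := slack_collinear (f := f) (f₀ := f₀) h x
  rw [hik, sub_self, zero_div] at hs
  have s1 : 0 ≤ (edgeForm p i j x - f s(i, j)) / dist (p i) (p j) :=
    div_nonneg (sub_nonneg.2 (hx.2.1 i j hne1)) hd1.le
  have s2 : 0 ≤ (edgeForm p j k x - f s(j, k)) / dist (p j) (p k) :=
    div_nonneg (sub_nonneg.2 (hx.2.1 j k hne2)) hd2.le
  have s3 := hx.2.2 j
  have e1 : (edgeForm p i j x - f s(i, j)) / dist (p i) (p j) = 0 := by linarith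
  have e2 : (edgeForm p j k x - f s(j, k)) / dist (p j) (p k) = 0 := by linarith
  rw [div_eq_zero_iff, or_iff_left hd1.ne', sub_eq_zero] at e1
  rw [div_eq_zero_iff, or_iff_left hd2.ne', sub_eq_zero] at e2
  exact ⟨e1, e2, by linarith, by linarith⟩

/-! ### Points of the polyhedron -/

/-- The form `edgeForm p i j` as a linear map. -/
noncomputable def edgeLinear (p : ι → Plane) (i j : ι) : Motion ι →ₗ[ℝ] ℝ where
  toFun := edgeForm p i j
  map_add' x y := by
    simp only [edgeForm, Prod.fst_add, Prod.snd_add, Pi.add_apply, inner_sub_right,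
      inner_add_right]
    ring
  map_smul' c x := by
    simp only [edgeForm, Prod.smul_fst, Prod.smul_snd, Pi.smul_apply, inner_sub_right,
      inner_smul_right, smul_eq_mul, RingHom.id_apply]
    ring

lemma edgeForm_add_velocity (v w : ι → Plane) (t : ι → ℝ) (c : ℝ) (i j : ι) :
    edgeForm p i j (v + c • w, t) =
      edgeForm p i j (v, t) + c * inner ℝ (p i - p j) (w i - w j) := by
  simp only [edgeForm, Pi.add_apply, Pi.smul_apply, inner_sub_right, inner_add_right,
    inner_smul_right]
  ring

/-- Every velocity can be normalised by adding a rigid motion. -/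
lemma exists_normalized (hab : p a 1 ≠ p b 1) (v : ι → Plane) :
    ∃ v' : ι → Plane, (∀ t : ι → ℝ, ((v', t) : Motion ι) ∈ normalizedMotions a b) ∧
      ∀ (t : ι → ℝ) i j, edgeForm p i j (v', t) = edgeForm p i j (v, t) := by
  have hab' : p b 1 - p a 1 ≠ 0 := sub_ne_zero.2 hab.symm
  refine ⟨fun l => v l - v a + ((v b 0 - v a 0) / (p b 1 - p a 1)) • rot (p l - p a), ?_, ?_⟩
  · intro t
    refine ⟨by simp [rot], by simp [rot], ?_⟩
    simp [rot]
    field_simp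
    ring
  · intro t i j
    have : ∀ c : ℝ, (v i - v a + c • rot (p i - p a)) - (v j - v a + c • rot (p j - p a)) =
        (v i - v j) + c • rot (p i - p j) := by
      intro c
      apply plane_ext <;> simp [rot] <;> ring
    have hself : inner ℝ (p i - p j) (rot (p i - p j)) = 0 := by
      rw [real_inner_comm, inner_rot, det2]; ring
    simp only [edgeForm, this, inner_add_right, inner_smul_right, hself, mul_zero, add_zero]

lemma eventually_le_add_mul {A B c : ℝ} (h : 0 < B ∨ B = 0 ∧ c ≤ A) :
    ∀ᶠ R in Filter.atTop, c ≤ A + R * B := by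
  rcases h with h | ⟨rfl, h⟩
  · filter_upwards [Filter.eventually_ge_atTop ((c - A) / B)] with R hR
    rw [div_le_iff₀ h] at hR
    linarith
  · simp [h]

/-- Any two vectors of marks that satisfy their constraints can be completed, by one large
dilation, to points of the polyhedron. -/
lemma exists_velocity [Finite ι] (hp : Function.Injective p) (hab : p a 1 ≠ p b 1)
    (f : Sym2 ι → ℝ) {t t' : ι → ℝ} (ht : ∀ i, f₀ i ≤ t i) (ht' : ∀ i, f₀ i ≤ t' i) :
    ∃ v : ι → Plane, ((v, t) : Motion ι) ∈ expansionPolyhedron p a b f f₀ ∧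
      ((v, t') : Motion ι) ∈ expansionPolyhedron p a b f f₀ := by
  have hev : ∀ t : ι → ℝ, ∀ᶠ R : ℝ in Filter.atTop, ∀ i j, i ≠ j →
      f s(i, j) ≤ edgeForm p i j (0 + R • p, t) := by
    intro t
    refine Filter.eventually_all.2 fun i => Filter.eventually_all.2 fun j => ?_
    by_cases hij : i = j
    · simp [hij]
    · simp only [edgeForm_add_velocity]
      filter_upwards [eventually_le_add_mul (c := f s(i, j)) (A := edgeForm p i j (0, t))
        (Or.inl (real_inner_self_pos.2 (sub_ne_zero.2 (hp.ne hij))))] with R hR _ using hR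
  obtain ⟨R, hR, hR'⟩ := ((hev t).and (hev t')).exists
  obtain ⟨v, hv, hvf⟩ := exists_normalized hab (0 + R • p)
  exact ⟨v, ⟨hv t, fun i j hij => by rw [hvf]; exact hR i j hij, ht⟩,
    hv t', fun i j hij => by rw [hvf]; exact hR' i j hij, ht'⟩

/-- The inequality of an edge that contains a further point of the set does not define a facet:
its face has codimension at least two, being tight on a shorter edge and on a mark. -/
lemma not_isFacet_of_sbtw [Fintype ι] (hp : Function.Injective p) (hab : p a 1 ≠ p b 1)
    {i j k : ι} (h : Sbtw ℝ (p i) (p j) (p k)) (h3 : 0 ≤ tripleSum p f f₀ i j k) :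
    ¬ IsFacet (expansionPolyhedron p a b f f₀)
      {x ∈ expansionPolyhedron p a b f f₀ | edgeForm p i k x = f s(i, k)} := by
  classical
  rintro ⟨-, -, hdim⟩
  set Y := expansionPolyhedron p a b f f₀
  set F := {x ∈ Y | edgeForm p i k x = f s(i, k)}
  have hij : i ≠ j := fun e => h.left_ne (congrArg p e)
  -- a single mark can be changed within the polyhedron
  have hmark : ∀ l, ((0, Pi.single l 1) : Motion ι) ∈ vectorSpan ℝ Y := by
    intro l
    obtain ⟨v, hv, hv'⟩ := exists_velocity hp hab f (t := f₀ + Pi.single l 1) (t' := f₀)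
      (fun i => by simp [Pi.single_apply]; split_ifs <;> norm_num) (fun i => le_rfl)
    have := vsub_mem_vectorSpan ℝ hv hv'
    simpa using this
  set τ : Motion ι →ₗ[ℝ] ℝ := (LinearMap.proj j).comp (LinearMap.snd ℝ (ι → Plane) (ι → ℝ))
  have hτ : ∀ x : Motion ι, τ x = x.2 j := fun x => rfl
  have hF : vectorSpan ℝ F ≤
      (vectorSpan ℝ Y ⊓ LinearMap.ker τ) ⊓ LinearMap.ker (edgeLinear p i j) := by
    rw [vectorSpan_def, Submodule.span_le]
    rintro _ ⟨x, hx, y, hy, rfl⟩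
    obtain ⟨hx1, -, hx2, -⟩ := tight_of_collinear h h3 hx.1 hx.2
    obtain ⟨hy1, -, hy2, -⟩ := tight_of_collinear h h3 hy.1 hy.2
    refine ⟨⟨vsub_mem_vectorSpan ℝ hx.1 hy.1, ?_⟩, ?_⟩
    · simp [hτ, hx2, hy2]
    · have : edgeLinear p i j (x - y) = edgeForm p i j x - edgeForm p i j y :=
        map_sub (edgeLinear p i j) x y
      simp [this, hx1, hy1]
  have hlt1 : vectorSpan ℝ Y ⊓ LinearMap.ker τ < vectorSpan ℝ Y := by
    refine lt_of_le_of_ne inf_le_left fun heq => ?_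
    have := (heq.ge (hmark j)).2
    simp [hτ] at this
  have hlt2 : (vectorSpan ℝ Y ⊓ LinearMap.ker τ) ⊓ LinearMap.ker (edgeLinear p i j) <
      vectorSpan ℝ Y ⊓ LinearMap.ker τ := by
    refine lt_of_le_of_ne inf_le_left fun heq => ?_
    have hmem : ((0, Pi.single i 1) : Motion ι) ∈ vectorSpan ℝ Y ⊓ LinearMap.ker τ :=
      ⟨hmark i, by simp [hτ, hij.symm]⟩
    have h0 : edgeForm p i j ((0, Pi.single i 1) : Motion ι) = 0 := (heq.ge hmem).2
    simp [edgeForm, hij.symm] at h0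
    exact h.left_ne h0
  have f1 := Submodule.finrank_mono hF
  have f2 := Submodule.finrank_lt_finrank_of_lt hlt1
  have f3 := Submodule.finrank_lt_finrank_of_lt hlt2
  omega

/-- If the inequality of a triple of consecutive collinear points is an equality, then the
inequality of its long edge is tight somewhere on the polyhedron. The point is found by making the
two short edges and all marks tight, then stretching the set along the line outside the triple,
and then stretching it much more across the line. -/
lemma exists_tight_of_tripleSum_eq_zero [Finite ι] (hp : Function.Injective p)
    (hab : p a 1 ≠ p b 1) {i j k : ι} (h : IsConsecutiveTriple p i j k)
    (h3 : tripleSum p f f₀ i j k = 0) :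
    ∃ x ∈ expansionPolyhedron p a b f f₀, edgeForm p i k x = f s(i, k) := by
  classical
  obtain ⟨hjk, r, hr, hij⟩ := sbtw_iff_opposite.1 h.1
  have nij : i ≠ j := fun e => h.1.left_ne (congrArg p e)
  have njk : j ≠ k := fun e => h.1.ne_right (congrArg p e)
  have nik : i ≠ k := fun e => h.1.left_ne_right (congrArg p e)
  set e := p k - p j with he
  have he0 : e ≠ 0 := sub_ne_zero.2 hjk.symm
  have hN : 0 < inner ℝ e e := real_inner_self_pos.2 he0
  -- coordinates along and across the line of the triple
  set X : ι → ℝ := fun l => inner ℝ (p l - p j) e with hX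
  set y : ι → ℝ := fun l => det2 e (p l - p j) with hy
  have hXj : X j = 0 := by simp [hX]
  have hXk : X k = inner ℝ e e := rfl
  have hXi : X i = -r * inner ℝ e e := by simp only [hX, hij, real_inner_smul_left]
  have hyj : y j = 0 := by simp [hy, det2]
  have hyk : y k = 0 := by simp only [hy, det2, ← he]; ring
  have hyi : y i = 0 := by simp only [hy, hij, det2, PiLp.smul_apply, smul_eq_mul]; ring
  have hXi0 : X i < 0 := by rw [hXi]; nlinarith
  have hXk0 : 0 < X k := by rw [hXk]; exact hN
  have hXsub : ∀ l m (c : ℝ), inner ℝ (p l - p m) (c • e) = c * (X l - X m) := by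
    intro l m c
    simp only [hX, inner_smul_right, ← inner_sub_left, sub_sub_sub_cancel_right]
  have hXne : ∀ l m, l ≠ m → y l = y m → X l ≠ X m := by
    intro l m hlm hylm hXlm
    have h1 : det2 e (p l - p m) = 0 := by
      have : det2 e (p l - p m) = y l - y m := by simp [hy, det2]; ring
      rw [this, hylm, sub_self]
    obtain ⟨c, hc⟩ := exists_eq_smul_of_det2_eq_zero he0 h1
    have h2 := hXsub l m 1
    rw [hXlm, sub_self, mul_zero, one_smul, hc, real_inner_smul_left] at h2
    have hc0 : c = 0 := by simpa [he0] using h2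
    rw [hc0, zero_smul, sub_eq_zero] at hc
    exact hlm (hp hc)
  have hout : ∀ l, l ≠ i → l ≠ j → l ≠ k → y l = 0 → X l < X i ∨ X k < X l := by
    intro l hli hlj hlk hyl
    by_contra hcon
    push Not at hcon
    obtain ⟨c, hc⟩ := exists_eq_smul_of_det2_eq_zero he0 hyl
    have hXl : X l = c * inner ℝ e e := by simp only [hX, hc, real_inner_smul_left]
    rw [hXl, hXi, hXk] at hcon
    have hc1 : -r ≤ c := le_of_mul_le_mul_right hcon.1 hN
    have hc2 : c ≤ 1 := by nlinarith [hcon.2]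
    refine hlj (h.2 l ⟨?_, hp.ne hli, hp.ne hlk⟩)
    have hr' : 0 < 1 + r := by linarith
    refine ⟨(c + r) / (1 + r), ⟨div_nonneg (by linarith) hr'.le,
      by rw [div_le_one hr']; linarith⟩, ?_⟩
    have hpi : p i = p j + (-r) • e := by rw [← hij]; abel
    have hpl : p l = p j + c • e := by rw [← hc]; abel
    have hpk : p k = p j + e := by rw [he]; abel
    have hd : p k - p i = (1 + r) • e := by rw [hpi, hpk]; module
    rw [AffineMap.lineMap_apply_module', hd, smul_smul, div_mul_cancel₀ _ hr'.ne', hpi, hpl]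
    module
  -- the two short edges and all marks are tight
  set ci := (f s(i, j) + dist (p i) (p j) * (f₀ i + f₀ j)) / X i with hci
  set ck := (f s(k, j) + dist (p k) (p j) * (f₀ k + f₀ j)) / X k with hck
  set v₀ : ι → Plane := fun l => if l = i then ci • e else if l = k then ck • e else 0 with hv₀
  have t1 : edgeForm p i j (v₀, f₀) = f s(i, j) := by
    have h1 : v₀ i - v₀ j = ci • e := by simp [hv₀, nij.symm, njk]
    simp only [edgeForm, h1, hXsub, hXj, hci, sub_zero]
    rw [div_mul_cancel₀ _ hXi0.ne]; ring
  have t2 : edgeForm p k j (v₀, f₀) = f s(k, j) := by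
    have h1 : v₀ k - v₀ j = ck • e := by simp [hv₀, nij.symm, njk, nik.symm]
    simp only [edgeForm, h1, hXsub, hXj, hck, sub_zero]
    rw [div_mul_cancel₀ _ hXk0.ne']; ring
  have t2' : edgeForm p j k (v₀, f₀) = f s(j, k) := by
    rw [edgeForm_comm, t2, Sym2.eq_swap]
  have t3 : edgeForm p i k (v₀, f₀) = f s(i, k) := by
    have hs := slack_collinear (f := f) (f₀ := f₀) h.1 (v₀, f₀)
    rw [t1, t2', h3] at hs
    simp only [sub_self, zero_div, mul_zero, add_zero] at hs
    rw [div_eq_zero_iff, or_iff_left (dist_pos.2 h.1.left_ne_right).ne', sub_eq_zero] at hs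
    exact hs
  -- stretching along the line, with the triple fixed
  set w₁ : ι → Plane := fun l => (if l = i ∨ l = k then 0 else X l) • e with hw₁
  have hw₁' : ∀ l m, inner ℝ (p l - p m) (w₁ l - w₁ m) =
      ((if l = i ∨ l = k then 0 else X l) - (if m = i ∨ m = k then 0 else X m)) *
        (X l - X m) := by
    intro l m
    rw [hw₁, ← sub_smul, hXsub]
  have hstretch : ∀ l m, (l = i ∨ l = k) → m ≠ i → m ≠ j → m ≠ k → y m = 0 →
      0 < inner ℝ (p l - p m) (w₁ l - w₁ m) := by
    intro l m hl hmi hmj hmk hym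
    rw [hw₁', if_pos hl, if_neg (by tauto)]
    rcases hout m hmi hmj hmk hym with h1 | h1 <;> rcases hl with rfl | rfl <;> nlinarith
  have hlevel : ∀ l m, l ≠ m → y l = y m → 0 < inner ℝ (p l - p m) (w₁ l - w₁ m) ∨
      inner ℝ (p l - p m) (w₁ l - w₁ m) = 0 ∧ f s(l, m) ≤ edgeForm p l m (v₀, f₀) := by
    have hin : ∀ l m, l ≠ m → (l = i ∨ l = k) → y l = y m →
        0 < inner ℝ (p l - p m) (w₁ l - w₁ m) ∨
        inner ℝ (p l - p m) (w₁ l - w₁ m) = 0 ∧ f s(l, m) ≤ edgeForm p l m (v₀, f₀) := by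
      intro l m hlm hl hylm
      by_cases hm : m = i ∨ m = j ∨ m = k
      · right
        constructor
        · rw [hw₁', if_pos hl]
          rcases hm with rfl | rfl | rfl <;> simp [hXj]
        · rcases hl with rfl | rfl <;> rcases hm with rfl | rfl | rfl
          · exact absurd rfl hlm
          · exact t1.ge
          · exact t3.ge
          · rw [edgeForm_comm, Sym2.eq_swap]; exact t3.ge
          · exact t2.ge
          · exact absurd rfl hlm
      · push Not at hm
        refine Or.inl (hstretch l m hl hm.1 hm.2.1 hm.2.2 ?_)
        rw [← hylm]
        rcases hl with rfl | rfl <;> assumption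
    intro l m hlm hylm
    by_cases hl : l = i ∨ l = k
    · exact hin l m hlm hl hylm
    by_cases hm : m = i ∨ m = k
    · rw [edgeForm_comm, Sym2.eq_swap, ← neg_sub (p m), ← neg_sub (w₁ m), inner_neg_neg]
      exact hin m l hlm.symm hm hylm.symm
    · left
      rw [hw₁', if_neg hl, if_neg hm, ← sq]
      exact sq_pos_of_ne_zero (sub_ne_zero.2 (hXne l m hlm hylm))
  have hev₁ : ∀ᶠ R : ℝ in Filter.atTop, ∀ l m, l ≠ m → y l = y m →
      f s(l, m) ≤ edgeForm p l m (v₀ + R • w₁, f₀) := by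
    refine Filter.eventually_all.2 fun l => Filter.eventually_all.2 fun m => ?_
    by_cases hlm : l ≠ m ∧ y l = y m
    · simp only [edgeForm_add_velocity]
      filter_upwards [eventually_le_add_mul (hlevel l m hlm.1 hlm.2)] with R hR _ _ using hR
    · exact Filter.Eventually.of_forall fun R h1 h2 => absurd ⟨h1, h2⟩ hlm
  obtain ⟨R₁, hR₁⟩ := hev₁.exists
  -- stretching across the line
  set w₂ : ι → Plane := fun l => y l • rot e with hw₂
  have hw₂' : ∀ l m, inner ℝ (p l - p m) (w₂ l - w₂ m) = (y l - y m) ^ 2 := by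
    intro l m
    rw [hw₂, ← sub_smul, inner_smul_right, real_inner_comm, inner_rot, sq]
    congr 1
    simp [hy, det2]; ring
  have hev₂ : ∀ᶠ R : ℝ in Filter.atTop, ∀ l m, l ≠ m →
      f s(l, m) ≤ edgeForm p l m (v₀ + R₁ • w₁ + R • w₂, f₀) := by
    refine Filter.eventually_all.2 fun l => Filter.eventually_all.2 fun m => ?_
    by_cases hlm : l = m
    · simp [hlm]
    · simp only [edgeForm_add_velocity _ w₂, hw₂']
      have : 0 < (y l - y m) ^ 2 ∨ (y l - y m) ^ 2 = 0 ∧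
          f s(l, m) ≤ edgeForm p l m (v₀ + R₁ • w₁, f₀) := by
        by_cases hylm : y l = y m
        · exact Or.inr ⟨by rw [hylm]; ring, hR₁ l m hlm hylm⟩
        · exact Or.inl (sq_pos_of_ne_zero (sub_ne_zero.2 hylm))
      filter_upwards [eventually_le_add_mul this] with R hR _ using hR
  obtain ⟨R₂, hR₂⟩ := hev₂.exists
  obtain ⟨v, hv, hvf⟩ := exists_normalized hab (v₀ + R₁ • w₁ + R₂ • w₂)
  refine ⟨(v, f₀), ⟨hv f₀, fun l m hlm => by rw [hvf]; exact hR₂ l m hlm, fun _ => le_rfl⟩, ?_⟩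
  rw [hvf, edgeForm_add_velocity, edgeForm_add_velocity, t3, hw₁', hw₂', hyi, hyk]
  simp

lemma isExposed_edge [Fintype ι] {i k : ι} (hik : i ≠ k) :
    IsExposed ℝ (expansionPolyhedron p a b f f₀)
      {x ∈ expansionPolyhedron p a b f f₀ | edgeForm p i k x = f s(i, k)} := by
  rintro ⟨z, hz, hzik⟩
  refine ⟨LinearMap.toContinuousLinearMap (-edgeLinear p i k), ?_⟩
  have hval : ∀ x, LinearMap.toContinuousLinearMap (-edgeLinear p i k) x = -edgeForm p i k x :=
    fun _ => rfl
  ext x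
  simp only [hval, neg_le_neg_iff]
  refine and_congr_right fun hx => ⟨fun h y hy => ?_, fun h => ?_⟩
  · rw [h]; exact hy.2.1 i k hik
  · exact le_antisymm (hzik ▸ h z hz) (hx.2.1 i k hik)

/-- If the inequalities of all triples of consecutive points are strict, then no edge containing a
further point of the set is ever tight: a shortest such edge would be the long edge of a
consecutive triple. -/
lemma not_sbtw_of_tight [Finite ι]
    (h3 : ∀ i j k, Sbtw ℝ (p i) (p j) (p k) → 0 ≤ tripleSum p f f₀ i j k)
    (h3' : ∀ i j k, IsConsecutiveTriple p i j k → 0 < tripleSum p f f₀ i j k)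
    (hp : Function.Injective p) (hx : x ∈ expansionPolyhedron p a b f f₀) {i j k : ι}
    (hik : edgeForm p i k x = f s(i, k)) : ¬ Sbtw ℝ (p i) (p j) (p k) := by
  intro hs
  obtain ⟨⟨i, k⟩, ⟨hik, j, hs⟩, hmin⟩ := Set.exists_min_image
    {q : ι × ι | edgeForm p q.1 q.2 x = f s(q.1, q.2) ∧ ∃ j, Sbtw ℝ (p q.1) (p j) (p q.2)}
    (fun q => dist (p q.1) (p q.2)) (Set.toFinite _) ⟨(i, k), hik, j, hs⟩
  simp only at hik hs hmin
  obtain ⟨hij, hjk, -, h0⟩ := tight_of_collinear hs (h3 _ _ _ hs) hx hik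
  refine (h3' i j k ⟨hs, fun l hl => ?_⟩).ne' h0
  by_contra hlj
  have hd := hs.wbtw.dist_add_dist
  rcases sbtw_or_sbtw hs hl (hp.ne hlj) with h | h
  · have := hmin (i, j) ⟨hij, l, h⟩
    have := dist_pos.2 hs.ne_right
    simp only at *
    linarith
  · have := hmin (j, k) ⟨hjk, l, h⟩
    have := dist_pos.2 hs.left_ne
    simp only at *
    linarith

end Polyhedron

theorem mainTheorem11 {ι : Type*} [Fintype ι] (p : ι → Plane) (hp : Function.Injective p)
    (a b : ι) (hab : p a 1 ≠ p b 1) (hA : NoThreeCollinearBoundary p)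
    (f : Sym2 ι → ℝ) (f₀ : ι → ℝ)
    (h4 : FourPointInequalities p f f₀)
    (h3 : ∀ i j k, Sbtw ℝ (p i) (p j) (p k) → 0 ≤ tripleSum p f f₀ i j k)
    (h5 : FivePointInequalities p f f₀) :
    WeaklyValid p a b f f₀ ∧
    ((∀ i j k, Sbtw ℝ (p i) (p j) (p k) → 0 < tripleSum p f f₀ i j k) →
      StrictlyValid p a b f f₀) ∧
    (StrictlyValid p a b f f₀ ↔
      ∀ i j k, IsConsecutiveTriple p i j k → 0 < tripleSum p f f₀ i j k) := by
  have hstrict : (∀ i j k, IsConsecutiveTriple p i j k → 0 < tripleSum p f f₀ i j k) →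
      StrictlyValid p a b f f₀ := by
    rintro h3' F hF ⟨x, hxF⟩
    have hx := hF.subset hxF
    exact nonCrossing_of_tight hp hA h4 h5 hx (fun i j hij => hij.2 x hxF) (fun i hi => hi x hxF)
      fun i j k hik => not_sbtw_of_tight h3 h3' hp hx (hik.2 x hxF)
  refine ⟨?_, fun h => hstrict fun i j k hijk => h i j k hijk.1, ?_, hstrict⟩
  · rintro F hF ⟨x, hxF⟩
    exact nonCrossing_of_tight hp hA h4 h5 (hF.subset hxF) (fun i j hij => hij.1.2 x hxF)
      (fun i hi => hi.1 x hxF)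
      fun i j k hik hs => not_isFacet_of_sbtw hp hab hs (h3 i j k hs) hik.2
  · intro hval i j k hijk
    refine lt_of_le_of_ne (h3 i j k hijk.1) fun h0 => ?_
    have hik : i ≠ k := fun e => hijk.1.left_ne_right (congrArg p e)
    obtain ⟨x, hx, hxik⟩ := exists_tight_of_tripleSum_eq_zero hp hab hijk h0.symm
    have hnc := hval _ (isExposed_edge hik) ⟨x, hx, hxik⟩
    rcases hnc.1.1 i k j ⟨hik, fun y hy => hy.2⟩ (mem_segment_iff_wbtw.2 hijk.1.wbtw) with h | h
    · exact hijk.1.ne_left (congrArg p h)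
    · exact hijk.1.ne_right (congrArg p h)
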